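/- For $n \ge 1$, an *$n$-tape automaton* over a finite nonempty alphabet $\Sigma$ consists of a finite set of states $Q$, a map $\tau$ assigning to each state the tape read in it, a nondeterministic transition function $\delta : Q \times (\Sigma \cup \{\$\}) \to \mathcal P(Q)$, where $\$ \notin \Sigma$ is an end-marker, and sets of initial and of accepting states. On input $(x_1, \ldots, x_n) \in (\Sigma^*)^n$ the tapes contain $x_1\$, \ldots, x_n\$$; in state $q$ the automaton reads and consumes the next symbol $s$ on tape $\tau(q)$, if there is one, and moves to some state in $\delta(q, s)$. The input is accepted if some finite (possibly empty) sequence of such moves from an initial state reaches an accepting state (whether or not all tapes have been read completely). The set of accepted $n$-tuples of words is the language $L(A) \subseteq (\Sigma^*)^n$ of the automaton $A$; a subset of $(\Sigma^*)^n$ is *rational* if it is the language of some $n$-tape automaton over $\Sigma$. The *rational intersection problem* asks, given a number $n \ge 1$, a finite nonempty alphabet $\Sigma$, and two $n$-tape automata $A, B$ over $\Sigma$ (all by finite descriptions), whether $L(A) \cap L(B)$ is rational. **Theorem.** The rational intersection problem is undecidable. Moreover, for every fixed $n \ge 3$ (in particular for $n = 3$), its restriction to $n$-tape automata is undecidable.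 -/

import Mathlib

/-- A nondeterministic finite-state automaton with `n` read-only tapes over the alphabet `σ` and
with state set `Q`. The extended alphabet, `σ` with the right end-marker, is `Option σ`, where
`none` is the end-marker. Finiteness of `σ` and `Q` is required where automata are used. -/
structure MultiTapeAutomaton (n : ℕ) (σ Q : Type) where
  /-- the tape that is read in a state -/
  tape : Q → Fin n
  /-- the nondeterministic transition function -/
  step : Q → Option σ → Set Q
  /-- the initial states -/
  start : Set Q
  /-- the accepting states -/
  accept : Set Q

namespace MultiTapeAutomaton

/-- A configuration: the current state and, for each tape, the input still to be read. -/
abbrev Config (n : ℕ) (σ Q : Type) : Type := Q × (Fin n → List (Option σ))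

/-- One move of the automaton: read (and consume) one symbol, possibly the end-marker, on the tape
of the current state, and leave the other tapes as they are. -/
def Move {n : ℕ} {σ Q : Type} (A : MultiTapeAutomaton n σ Q) (c d : Config n σ Q) : Prop :=
  ∃ (s : Option σ) (rest : List (Option σ)),
    c.2 (A.tape c.1) = s :: rest ∧
    d.1 ∈ A.step c.1 s ∧
    d.2 = Function.update c.2 (A.tape c.1) rest

/-- The content of the tapes on input `x`: each word is followed by the end-marker. -/
def input {n : ℕ} {σ : Type} (x : Fin n → List σ) : Fin n → List (Option σ) :=
  fun i => (x i).map some ++ [none]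

/-- `A` accepts `x` if some run (a finite, possibly empty, sequence of moves from an initial
configuration on `x`) ends in an accepting state; the tapes need not have been read completely. -/
def Accepts {n : ℕ} {σ Q : Type} (A : MultiTapeAutomaton n σ Q) (x : Fin n → List σ) : Prop :=
  ∃ q₀ ∈ A.start, ∃ c : Config n σ Q,
    Relation.ReflTransGen A.Move (q₀, input x) c ∧ c.1 ∈ A.accept

/-- The language of `A`: the set of all `n`-words that `A` accepts. -/
def language {n : ℕ} {σ Q : Type} (A : MultiTapeAutomaton n σ Q) : Set (Fin n → List σ) :=
  {x | A.Accepts x}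

end MultiTapeAutomaton

/-- A set of `n`-words over `σ` is rational if some `n`-tape automaton over `σ` with finitely many
states accepts it. -/
def IsRationalLanguage {n : ℕ} {σ : Type} (L : Set (Fin n → List σ)) : Prop :=
  ∃ (Q : Type) (_ : Finite Q) (A : MultiTapeAutomaton n σ Q), A.language = L

/-- Finite descriptions of multi-tape automata: the list of the tapes read in the states `0, 1, …`
(its length is the number of states), the list of transitions `(q, s, q')` (where `s = none` is the
end-marker), the list of initial states and the list of accepting states. -/
abbrev AutomatonCode : Type :=
  List ℕ × List (ℕ × Option ℕ × ℕ) × List ℕ × List ℕ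

/-- The `n`-tape automaton over the alphabet `{0, …, k - 1}` that a code describes. Tape numbers are
read modulo `n`; entries that mention a symbol or a state out of range have no effect. -/
def AutomatonCode.toAutomaton (n : ℕ) [NeZero n] (k : ℕ) (c : AutomatonCode) :
    MultiTapeAutomaton n (Fin k) (Fin c.1.length) where
  tape q := Fin.ofNat n (c.1.get q)
  step q s := {q' | ((q : ℕ), s.map Fin.val, (q' : ℕ)) ∈ c.2.1}
  start := {q | (q : ℕ) ∈ c.2.2.1}
  accept := {q | (q : ℕ) ∈ c.2.2.2}

/-- The rational intersection problem for `n`-tape automata. An instance `(k, a, b)` consists of two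
automata `a`, `b` over the common nonempty finite alphabet `{0, …, k}`; the question is whether the
intersection of their languages is rational. -/
def RationalIntersection (n : ℕ) [NeZero n] (p : ℕ × AutomatonCode × AutomatonCode) : Prop :=
  IsRationalLanguage
    ((p.2.1.toAutomaton n (p.1 + 1)).language ∩ (p.2.2.toAutomaton n (p.1 + 1)).language)

open Turing

/-! The halting problem is reduced to rational intersection through a variant of Post's
correspondence problem, `LagSolvable E h C`. Fix one Turing machine whose halting on inputs indexed
by `m` is undecidable. Let `E` consist of its rewriting rules, including all pairs `([x], [x])`, and
let `C` be the word of the initial configuration. In an equation `u ++ h :: rest = C ++ v` with `(u,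
v)` generated by `E`, the right side is one configuration ahead of `u`. It therefore spells out a
computation, and the letter `h` can appear in it only if the machine halts
(`TMSymbol.lagSolvable_init_iff`).

The two automata use three tapes; further tapes are never read. `pairAutomaton` requires, for some
`(u, v)` generated by `E`, that `u h` is a prefix of tape 0, that tape 1 is `v`, and that `h ^ |v|
b` is a prefix of tape 2. `copyAutomaton` forces tape 0 to be `C` followed by tape 1, and the number
of letters `b` on tape 2 to be the length of tape 1. A common tuple yields a solution, so without
solutions the intersection is empty, hence rational. From a solution, prepending `C` to both `u` and
`v` yields solutions with arbitrarily long `v`. Then tape 2 carries `h ^ i b ^ i` for arbitrarily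
large `i`, but `h ^ i b ^ j` only if `i = j`; a cut-and-paste argument (`not_isRationalLanguage`)
shows that this is impossible for a rational language. So the intersection is rational iff there is
no solution (`isRationalLanguage_inter_iff`).

The machine, the rules and the first automaton are fixed, and `C` depends on `m` only through a
block of `m + 1` equal letters. Codes of the fixed parts need only exist; the one construction that
must be computable is the attachment of a chain of `m + 2` states (`AutomatonCode.chain`). -/

/-! ### A fixed Turing machine with undecidable halting on unary blocks. -/

theorem Turing.PartrecToTM2.trNat_two_pow (m : ℕ) :
    PartrecToTM2.trNat (2 ^ m) =
      List.replicate m PartrecToTM2.Γ'.bit0 ++ [PartrecToTM2.Γ'.bit1] := by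
  induction m with
  | zero => simp [PartrecToTM2.trNat, PartrecToTM2.trNum]; rfl
  | succ m ih =>
    have h : ((2 ^ (m + 1) : ℕ) : Num) = Num.bit0 ((2 ^ m : ℕ) : Num) := by
      rw [pow_succ, mul_comm]
      exact_mod_cast (Num.bit0_of_bit0 ((2 ^ m : ℕ) : Num)).symm.trans (by push_cast; ring) |>.symm
    rw [PartrecToTM2.trNat, h]
    rw [PartrecToTM2.trNat] at ih
    rcases hx : ((2 ^ m : ℕ) : Num) with _ | p
    · rw [hx] at ih; simp [PartrecToTM2.trNum] at ih
    · rw [hx] at ih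
      simp only [PartrecToTM2.trNum] at ih
      simp [Num.bit0, PartrecToTM2.trNum, PartrecToTM2.trPosNum, ih, List.replicate_succ]

/-- One universal program suffices: on `2 ^ (m + 1)` it runs the `m`-th program on `0`. Powers of
two are used because their binary expansion is a block of equal digits and one final digit, so that
`m` enters the tape in unary. -/
theorem exists_toPartrec_code :
    ∃ c : ToPartrec.Code, ¬ ComputablePred fun m : ℕ => (c.eval [2 ^ (m + 1)]).Dom := by
  have pow : Primrec₂ (fun a b : ℕ => a ^ b) := Primrec₂.unpaired'.1 Nat.Primrec.pow
  -- The search recovers `m` from `n = 2 ^ (m + 1)`; on other arguments it diverges.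
  let g : ℕ →. ℕ := fun n =>
    (Nat.rfind fun m => Part.some (decide (2 ^ (m + 1) = n))).bind fun m =>
      (Denumerable.ofNat Nat.Partrec.Code m).eval 0
  have hg : Partrec g := by
    refine Partrec.bind (Partrec.rfind ?_) ?_
    · refine Computable.partrec ?_
      refine Primrec.to_comp ?_
      refine (Primrec.eq.comp (pow.comp (Primrec.const 2) (Primrec.succ.comp Primrec.snd))
        Primrec.fst).decide
    · exact Nat.Partrec.Code.eval_part.comp
        ((Computable.ofNat _).comp Computable.snd) (Computable.const 0)
  have hgm : ∀ m : ℕ, g (2 ^ (m + 1)) = (Denumerable.ofNat Nat.Partrec.Code m).eval 0 := by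
    intro m
    have : (Nat.rfind fun k => Part.some (decide (2 ^ (k + 1) = 2 ^ (m + 1)))) = Part.some m := by
      refine Part.eq_some_iff.2 (Nat.mem_rfind.2 ⟨by simp, ?_⟩)
      intro k hk
      have : k + 1 ≠ m + 1 := by omega
      simp [hk.ne]
    simp only [g, this, Part.bind_some]
  have hv : Partrec fun v : List.Vector ℕ 1 => g v.head :=
    hg.comp Primrec.vector_head.to_comp
  obtain ⟨c, hc⟩ := ToPartrec.Code.exists_code (Nat.Partrec'.part_iff.2 hv)
  refine ⟨c, fun h => ComputablePred.halting_problem 0 ?_⟩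
  have := ManyOneReducible.mk (fun m : ℕ => (c.eval [2 ^ (m + 1)]).Dom)
    (Computable.encode (α := Nat.Partrec.Code))
  refine (ComputablePred.computable_of_manyOneReducible this h).of_eq fun d => ?_
  have := hc ⟨[2 ^ (Encodable.encode d + 1)], rfl⟩
  simp only [List.Vector.head] at this
  rw [this, hgm]
  simp

/-- Restricting a machine to a supporting set of states does not change when it halts. -/
theorem Turing.TM0.exists_finite_of_supports {Γ Λ : Type} [Inhabited Γ] [Inhabited Λ]
    (M : TM0.Machine Γ Λ) (S : Set Λ) (hS : S.Finite) (ss : TM0.Supports M S) :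
    ∃ (Λ' : Type) (_ : Inhabited Λ') (_ : Finite Λ') (M' : TM0.Machine Γ Λ'),
      ∀ l, (TM0.eval M' l).Dom ↔ (TM0.eval M l).Dom := by
  classical
  let _ : Inhabited S := ⟨⟨default, ss.1⟩⟩
  -- States outside `S` are never reached, so their image is arbitrary.
  let g₁ : PointedMap Λ S := ⟨fun q => if h : q ∈ S then ⟨q, h⟩ else default, by
    simp only [ss.1, dite_true]; rfl⟩
  let f : PointedMap Γ Γ := ⟨id, rfl⟩
  refine ⟨S, inferInstance, hS, M.map f f g₁ Subtype.val, fun l => ?_⟩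
  have := TM0.Machine.map_respects M f f g₁ Subtype.val ss (fun _ => rfl) (fun q hq => by
    change (↑(if h : q ∈ S then (⟨q, h⟩ : S) else default) : Λ) = q
    simp [hq])
  have h := StateTransition.tr_eval_dom this (a₁ := TM0.init l) (a₂ := TM0.init l) ⟨ss.1, by
    have := TM0.map_init f g₁ l
    simpa [f] using this⟩
  simpa [TM0.eval] using h

/-- The program is compiled to a stack machine, then to one-tape machines, each translation coming
with a finite supporting set of states. The stack is laid out from its bottom, so the digits appear
reversed: separator, leading one, then the block of zeros. -/
theorem exists_undecidable_TM0 :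
    ∃ (Γ Λ : Type) (_ : Inhabited Γ) (_ : Inhabited Λ) (_ : Finite Γ) (_ : Finite Λ)
      (M : TM0.Machine Γ Λ) (a b c : Γ),
      ¬ ComputablePred fun m : ℕ => (TM0.eval M (c :: b :: List.replicate (m + 1) a)).Dom := by
  obtain ⟨C, hC⟩ := exists_toPartrec_code
  -- The default label is the start state, so this choice makes the machine start with the program
  -- `C`.
  let _ : Inhabited PartrecToTM2.Λ' := ⟨PartrecToTM2.trNormal C PartrecToTM2.Cont'.halt⟩
  have s2 := PartrecToTM2.tr_supports C PartrecToTM2.Cont'.halt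
  have s1 := TM2to1.tr_supports _ s2
  have s0 := TM1to0.tr_supports _ s1
  obtain ⟨Λ', i, hf, M', hM⟩ := TM0.exists_finite_of_supports _ _ (Finset.finite_toSet _) s0
  let sym : PartrecToTM2.Γ' → TM2to1.Γ' PartrecToTM2.K' (fun _ => PartrecToTM2.Γ') := fun x =>
    (false, Function.update (fun _ => none) PartrecToTM2.K'.main (some x))
  have hK : Finite PartrecToTM2.K' := Finite.of_surjective
    (fun i : Fin 4 => ![PartrecToTM2.K'.main, .rev, .aux, .stack] i) fun k => by
      cases k
      exacts [⟨0, rfl⟩, ⟨1, rfl⟩, ⟨2, rfl⟩, ⟨3, rfl⟩]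
  have hfin : Finite (Bool × (PartrecToTM2.K' → Option PartrecToTM2.Γ')) := inferInstance
  refine ⟨TM2to1.Γ' PartrecToTM2.K' (fun _ => PartrecToTM2.Γ'), Λ', inferInstance, i,
    hfin, hf, M', sym PartrecToTM2.Γ'.bit0, sym PartrecToTM2.Γ'.bit1,
    (true, (sym PartrecToTM2.Γ'.cons).2), fun h => hC (h.of_eq fun m => ?_)⟩
  have hw : (((true, (sym PartrecToTM2.Γ'.cons).2) ::
      sym PartrecToTM2.Γ'.bit1 :: List.replicate (m + 1) (sym PartrecToTM2.Γ'.bit0)) : List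
        (TM2to1.Γ' PartrecToTM2.K' (fun _ => PartrecToTM2.Γ'))) =
      TM2to1.trInit PartrecToTM2.K'.main (PartrecToTM2.trList [2 ^ (m + 1)]) := by
    have : (PartrecToTM2.trList [2 ^ (m + 1)]).reverse = PartrecToTM2.Γ'.cons ::
        PartrecToTM2.Γ'.bit1 :: List.replicate (m + 1) PartrecToTM2.Γ'.bit0 := by
      simp [PartrecToTM2.trNat_two_pow]
    rw [TM2to1.trInit, this, ← List.map_replicate]
    rfl
  rw [hw, hM, TM1to0.tr_eval]
  refine (TM2to1.tr_eval_dom PartrecToTM2.tr PartrecToTM2.K'.main _).trans ?_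
  have hi : (TM2.init PartrecToTM2.K'.main (PartrecToTM2.trList [2 ^ (m + 1)]) :
      PartrecToTM2.Cfg') = PartrecToTM2.init C [2 ^ (m + 1)] := by
    rw [TM2.init, PartrecToTM2.init]
    congr 1
    funext k
    cases k <;> simp [PartrecToTM2.K'.elim, Function.update]
  change (StateTransition.eval (TM2.step PartrecToTM2.tr) (TM2.init PartrecToTM2.K'.main
    (PartrecToTM2.trList [2 ^ (m + 1)]) : PartrecToTM2.Cfg')).Dom ↔ _
  rw [hi, PartrecToTM2.tr_eval]
  rfl

/-! ### Generated pairs of words and the correspondence problem. -/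

/-- `PairStar E u v`: the pair `(u, v)` is a componentwise concatenation of pairs from `E`. -/
inductive PairStar {σ : Type} (E : Set (List σ × List σ)) : List σ → List σ → Prop
  | nil : PairStar E [] []
  | cons {p q u v : List σ} : (p, q) ∈ E → PairStar E u v → PairStar E (p ++ u) (q ++ v)

namespace PairStar

variable {σ : Type} {E : Set (List σ × List σ)}

theorem single {p q : List σ} (h : (p, q) ∈ E) : PairStar E p q := by
  simpa using cons h nil

theorem append {u v u' v' : List σ} (h : PairStar E u v) (h' : PairStar E u' v') :
    PairStar E (u ++ u') (v ++ v') := by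
  induction h with
  | nil => simpa
  | cons hp _ ih => simpa [List.append_assoc] using cons hp ih

theorem refl (hE : ∀ x, ([x], [x]) ∈ E) (u : List σ) : PairStar E u u := by
  induction u with
  | nil => exact nil
  | cons x u ih => exact cons (hE x) ih

/-- A property of words that is stable under rewriting one factor is stable under `PairStar`. -/
theorem rewrite {P : List σ → Prop}
    (hP : ∀ X p q Y, (p, q) ∈ E → P (X ++ p ++ Y) → P (X ++ q ++ Y))
    {u v : List σ} (h : PairStar E u v) : ∀ X Y, P (X ++ u ++ Y) → P (X ++ v ++ Y) := by
  induction h with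
  | nil => exact fun _ _ h => h
  | @cons p q u v hp _ ih =>
    intro X Y hX
    have := hP X p q (u ++ Y) hp (by simpa using hX)
    simpa using ih (X ++ q) Y (by simpa using this)

/-- If a letter occurs only as the last letter in first components of `E`, then a `PairStar` can be
split after each of its occurrences. -/
theorem split {r : σ} (hr : ∀ p q a b, (p, q) ∈ E → p = a ++ r :: b → b = [])
    {w v : List σ} (h : PairStar E w v) : ∀ c u : List σ, w = c ++ r :: u →
      ∃ d v', v = d ++ v' ∧ PairStar E (c ++ [r]) d ∧ PairStar E u v' := by
  induction h with
  | nil => intro c u h; simp at h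
  | @cons p q u₀ v₀ hp hs ih =>
    intro c u h
    rcases List.append_eq_append_iff.1 h with ⟨a, rfl, ha⟩ | ⟨a, ha, ha'⟩
    · obtain ⟨d, v', rfl, h1, h2⟩ := ih _ _ ha
      exact ⟨q ++ d, v', by simp, by simpa using cons hp h1, h2⟩
    · rcases a with _ | ⟨x, a⟩
      · simp only [List.append_nil] at ha
        simp only [List.nil_append] at ha'
        subst ha
        obtain ⟨d, v', rfl, h1, h2⟩ := ih [] u ha'.symm
        exact ⟨q ++ d, v', by simp, cons hp h1, h2⟩
      -- The cut falls inside the first component `p`; since `r` can only be its last letter, the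
      -- cut is at the end of `p`.
      · simp only [List.cons_append, List.cons.injEq] at ha'
        obtain ⟨rfl, rfl⟩ := ha'
        have := hr _ _ _ _ hp ha
        subst this
        exact ⟨q, v₀, rfl, ha ▸ single hp, hs⟩

end PairStar

/-- The correspondence-type question behind the reduction: can a pair `(u, v)` generated by `E` be
chosen such that `C ++ v` is `u` followed by the letter `h` and arbitrary further letters? -/
def LagSolvable {σ : Type} (E : Set (List σ × List σ)) (h : σ) (C : List σ) : Prop :=
  ∃ u v rest, PairStar E u v ∧ u ++ h :: rest = C ++ v

/-! ### Simulation of a Turing machine by rewriting rules. -/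

/-- The letters used to write down configurations of a Turing machine. -/
inductive TMSymbol (Γ Λ : Type) : Type
  | tape (a : Γ) | state (q : Λ) | left | right | halted

instance TMSymbol.instFinite {Γ Λ : Type} [Finite Γ] [Finite Λ] : Finite (TMSymbol Γ Λ) :=
  Finite.of_surjective
    (fun x : Γ ⊕ Λ ⊕ Fin 3 => match x with
      | .inl a => TMSymbol.tape a
      | .inr (.inl q) => TMSymbol.state q
      | .inr (.inr i) => ![TMSymbol.left, TMSymbol.right, TMSymbol.halted] i) fun x => by
    cases x with
    | tape a => exact ⟨.inl a, rfl⟩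
    | state q => exact ⟨.inr (.inl q), rfl⟩
    | left => exact ⟨.inr (.inr 0), rfl⟩
    | right => exact ⟨.inr (.inr 1), rfl⟩
    | halted => exact ⟨.inr (.inr 2), rfl⟩

namespace TMSymbol

variable {Γ Λ : Type}

/-- The word for a configuration, where `r` is the tape from the scanned symbol on, and `l` the tape
to the left of it. -/
def word (r : List Γ) (q : Λ) (l : List Γ) : List (TMSymbol Γ Λ) :=
  left :: (r.reverse.map tape ++ state q :: (l.map tape ++ [right]))

theorem word_split_state {X Y : List (TMSymbol Γ Λ)} {r l : List Γ} {q q' : Λ}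
    (h : X ++ state q' :: Y = word r q l) :
    X = left :: r.reverse.map tape ∧ q' = q ∧ Y = l.map tape ++ [right] := by
  have h' : (left :: r.reverse.map tape) ++ state q :: (l.map tape ++ [right]) =
      X ++ state q' :: Y := by rw [h]; rfl
  rw [List.append_cons_inj_of_notMem (by simp) (by simp)] at h'
  simp_all

theorem word_split_tape_state {X Y : List (TMSymbol Γ Λ)} {r l : List Γ} {a : Γ} {q q' : Λ}
    (h : X ++ tape a :: state q' :: Y = word r q l) :
    q' = q ∧ Y = l.map tape ++ [right] ∧ ∃ r', r = a :: r' ∧ X = left :: r'.reverse.map tape := by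
  obtain ⟨h1, h2, h3⟩ := word_split_state (X := X ++ [tape a]) (by simpa using h)
  refine ⟨h2, h3, ?_⟩
  rcases r with _ | ⟨b, r⟩
  · rw [show (left :: List.map tape ([] : List Γ).reverse : List (TMSymbol Γ Λ)) = [] ++ [left]
      from rfl] at h1
    simpa using (List.append_inj' h1 rfl).2
  · have h1' : X ++ [tape a] = (left :: r.reverse.map tape) ++ [tape b] := by simpa using h1
    have := List.append_inj' h1' rfl
    simp only [List.cons.injEq, tape.injEq, and_true] at this
    exact ⟨r, by rw [this.2], this.1⟩

variable [Inhabited Γ]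

/-- The configuration that a word describes. -/
def cfg (r : List Γ) (q : Λ) (l : List Γ) : TM0.Cfg Γ Λ :=
  ⟨q, Tape.mk' (ListBlank.mk l) (ListBlank.mk r)⟩

theorem mk_append_default (l : List Γ) : ListBlank.mk (l ++ [default]) = ListBlank.mk l := by
  symm
  exact Quotient.sound' (Or.inl ⟨1, rfl⟩)

theorem cfg_pad (r : List Γ) (q : Λ) (l : List Γ) :
    cfg (r ++ [default]) q (l ++ [default]) = cfg r q l := by
  rw [cfg, cfg, mk_append_default, mk_append_default]

variable [Inhabited Λ]

/-- The rewriting rules that simulate a Turing machine. The scanned symbol stands immediately before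
the state, and the tape is written from right to left. -/
inductive Rule (M : TM0.Machine Γ Λ) : List (TMSymbol Γ Λ) → List (TMSymbol Γ Λ) → Prop
  | copy (x) : Rule M [x] [x]
  | padLeft : Rule M [left] [left, tape default]
  | padRight : Rule M [right] [tape default, right]
  | moveRight {q a q'} : M q a = some (q', .move .right) →
      Rule M [tape a, state q] [state q', tape a]
  | moveLeft {q a q'} (b) : M q a = some (q', .move .left) →
      Rule M [tape a, state q, tape b] [tape a, tape b, state q']
  | write {q a q' a'} : M q a = some (q', .write a') →
      Rule M [tape a, state q] [tape a', state q']
  | halt {q a} : M q a = none → Rule M [tape a, state q] [halted]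

/-- The pairs of sides of the rewriting rules. -/
def rules (M : TM0.Machine Γ Λ) : Set (List (TMSymbol Γ Λ) × List (TMSymbol Γ Λ)) :=
  {p | Rule M p.1 p.2}

theorem finite_rules [Finite Γ] [Finite Λ] (M : TM0.Machine Γ Λ) : (rules M).Finite := by
  refine ((List.finite_length_le _ 3).prod (List.finite_length_le _ 3)).subset ?_
  rintro ⟨p, q⟩ h
  cases h <;> simp

theorem step_cfg (M : TM0.Machine Γ Λ) (a : Γ) (r : List Γ) (q : Λ) (l : List Γ) :
    TM0.step M (cfg (a :: r) q l) = (M q a).map fun p => ⟨p.1, match p.2 with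
      | .move d => (cfg (a :: r) q l).Tape.move d
      | .write b => (cfg (a :: r) q l).Tape.write b⟩ := rfl

/-- A left side with a border or state letter fits into a configuration word in one place only.
Copying and padding leave the configuration unchanged, the rules for moves and writes perform one
machine step, and `halt` applies only where no step exists. -/
theorem rewrite_word {M : TM0.Machine Γ Λ} {p p' : List (TMSymbol Γ Λ)} (hp : Rule M p p')
    {X Y : List (TMSymbol Γ Λ)} {r l : List Γ} {q : Λ} (h : X ++ p ++ Y = word r q l) :
    (∃ r' q' l', X ++ p' ++ Y = word r' q' l' ∧ TM0.Reaches M (cfg r q l) (cfg r' q' l')) ∨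
      TM0.step M (cfg r q l) = none := by
  cases hp with
  | copy x => exact .inl ⟨r, q, l, h, .refl⟩
  | padLeft =>
    left
    have h' : [] ++ left :: (r.reverse.map tape ++ state q :: (l.map tape ++ [right])) =
      X ++ left :: Y := by simpa [word] using h.symm
    rw [List.append_cons_inj_of_notMem (by simp) (by simp)] at h'
    obtain ⟨rfl, -, rfl⟩ := h'
    refine ⟨r ++ [default], q, l, by simp [word], ?_⟩
    rw [cfg, cfg, mk_append_default]
    exact .refl
  | padRight =>
    left
    have h' : (left :: (r.reverse.map tape ++ state q :: l.map tape)) ++ right :: [] =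
      X ++ right :: Y := by simpa [word] using h.symm
    rw [List.append_cons_inj_of_notMem (by simp) (by simp)] at h'
    obtain ⟨rfl, -, rfl⟩ := h'
    refine ⟨r, q, l ++ [default], by simp [word], ?_⟩
    rw [cfg, cfg, mk_append_default]
    exact .refl
  | @moveRight q₀ a q' hM =>
    left
    obtain ⟨rfl, rfl, r', rfl, rfl⟩ := word_split_tape_state (a := a) (by simpa using h)
    refine ⟨r', q', a :: l, by simp [word], .single ?_⟩
    rw [step_cfg, hM]
    simp [cfg, Tape.move_right_mk']
  | @moveLeft q₀ a q' b hM =>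
    left
    obtain ⟨rfl, hY, r', rfl, rfl⟩ := word_split_tape_state (a := a) (Y := tape b :: Y)
      (by simpa using h)
    rcases l with _ | ⟨b', l⟩
    · simp at hY
    · simp only [List.map_cons, List.cons_append, List.cons.injEq, tape.injEq] at hY
      obtain ⟨rfl, rfl⟩ := hY
      refine ⟨b :: a :: r', q', l, by simp [word], .single ?_⟩
      rw [step_cfg, hM]
      simp [cfg, Tape.move_left_mk']
  | @write q₀ a q' a' hM =>
    left
    obtain ⟨rfl, rfl, r', rfl, rfl⟩ := word_split_tape_state (a := a) (by simpa using h)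
    refine ⟨a' :: r', q', l, by simp [word], .single ?_⟩
    rw [step_cfg, hM]
    simp [cfg, Tape.write_mk']
  | @halt q₀ a hM =>
    right
    obtain ⟨rfl, rfl, r', rfl, rfl⟩ := word_split_tape_state (a := a) (by simpa using h)
    rw [step_cfg, hM]
    rfl

/-- Solutions are peeled off one configuration at a time. If the machine never halts, the
configuration word must be a prefix of `u`. Cutting there leaves a solution with shorter `u` for the
word of a reachable configuration, which cannot go on forever. -/
theorem halts_of_lagSolvable {M : TM0.Machine Γ Λ} {r l : List Γ} {q : Λ}
    (h : LagSolvable (rules M) halted (word r q l)) :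
    ∃ c, TM0.Reaches M (cfg r q l) c ∧ TM0.step M c = none := by
  by_contra! hn
  let P : List (TMSymbol Γ Λ) → Prop := fun C =>
    ∃ r' q' l', C = word r' q' l' ∧ TM0.Reaches M (cfg r q l) (cfg r' q' l')
  have hP : ∀ X p p' Y, (p, p') ∈ rules M → P (X ++ p ++ Y) → P (X ++ p' ++ Y) := by
    rintro X p p' Y hp ⟨r₁, q₁, l₁, hw, hr⟩
    rcases rewrite_word hp hw with ⟨r₂, q₂, l₂, hw', hr'⟩ | hs
    · exact ⟨r₂, q₂, l₂, hw', hr.trans hr'⟩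
    · exact absurd hs (hn _ hr)
  have hr : ∀ p p' a b, (p, p') ∈ rules M → p = a ++ right :: b → b = [] := by
    rintro p p' a b hp rfl
    have hp : Rule M (a ++ right :: b) p' := hp
    generalize hx : a ++ right :: b = x at hp
    cases hp <;> rcases a with _ | ⟨_, _ | ⟨_, _ | ⟨_, a⟩⟩⟩ <;> simp_all
  have main : ∀ n, ∀ u v rest C, u.length ≤ n → P C → PairStar (rules M) u v →
      u ++ halted :: rest = C ++ v → False := by
    intro n
    induction n with
    | zero =>
      rintro u v rest C hu ⟨r', q', l', rfl, -⟩ - he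
      obtain rfl : u = [] := List.length_eq_zero_iff.1 (Nat.le_zero.1 hu)
      simp [word] at he
    | succ n ih =>
      rintro u v rest C hu ⟨r', q', l', rfl, hreach⟩ hs he
      have hh : halted ∉ word r' q' l' := by simp [word]
      -- The letter `halted` following `u` cannot lie within the configuration word, so this word
      -- ends before it.
      obtain ⟨u', rfl, rfl⟩ : ∃ u', u = word r' q' l' ++ u' ∧ v = u' ++ halted :: rest := by
        rcases List.append_eq_append_iff.1 he with ⟨a, ha, ha'⟩ | ⟨a, ha, ha'⟩
        · rcases a with _ | ⟨x, a⟩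
          · exact ⟨[], by simpa using ha.symm, by simpa using ha'.symm⟩
          · simp only [List.cons_append, List.cons.injEq] at ha'
            exact absurd (by simp [ha, ← ha'.1]) hh
        · exact ⟨a, ha, ha'⟩
      have hw : word r' q' l' = (left :: (r'.reverse.map tape ++ state q' :: l'.map tape)) ++
          [right] := by simp [word]
      obtain ⟨d, v', hv, h1, h2⟩ := hs.split hr
        (left :: (r'.reverse.map tape ++ state q' :: l'.map tape)) u' (by simp [word])
      rw [← hw] at h1
      -- Several rules may act at once on disjoint factors of the word; they are applied one after
      -- the other.
      have hd : P d := by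
        simpa using h1.rewrite hP [] [] (by simpa using ⟨r', q', l', rfl, hreach⟩)
      refine ih u' v' rest d ?_ hd h2 hv
      simp only [word, List.length_append, List.length_cons] at hu
      omega
  obtain ⟨u, v, rest, hs, he⟩ := h
  exact main _ u v rest _ le_rfl ⟨r, q, l, rfl, .refl⟩ hs he

theorem pairStar_refl (M : TM0.Machine Γ Λ) (u : List (TMSymbol Γ Λ)) :
    PairStar (rules M) u u :=
  PairStar.refl (fun x => Rule.copy x) u

theorem pairStar_context {M : TM0.Machine Γ Λ} {p p' : List (TMSymbol Γ Λ)} (h : Rule M p p')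
    (X Y : List (TMSymbol Γ Λ)) : PairStar (rules M) (X ++ (p ++ Y)) (X ++ (p' ++ Y)) :=
  (pairStar_refl M X).append ((PairStar.single h).append (pairStar_refl M Y))

/-- Solutions can be prolonged backwards along `PairStar` steps. -/
theorem lagSolvable_of_pairStar {M : TM0.Machine Γ Λ} {C D : List (TMSymbol Γ Λ)}
    (h : PairStar (rules M) C D) (hD : LagSolvable (rules M) halted D) :
    LagSolvable (rules M) halted C := by
  obtain ⟨u, v, rest, hs, he⟩ := hD
  exact ⟨C ++ u, D ++ v, rest, h.append hs, by simp [← he]⟩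

/-- The other rules need explicit symbols next to the state; padding by blanks provides them on both
sides. -/
theorem lagSolvable_word_pad {M : TM0.Machine Γ Λ} {r l : List Γ} {q : Λ}
    (h : LagSolvable (rules M) halted (word (r ++ [default]) q (l ++ [default]))) :
    LagSolvable (rules M) halted (word r q l) := by
  refine lagSolvable_of_pairStar (D := word (r ++ [default]) q l) ?_
    (lagSolvable_of_pairStar (D := word (r ++ [default]) q (l ++ [default])) ?_ h)
  · simpa [word] using pairStar_context (Rule.padLeft (M := M)) []
      (r.reverse.map tape ++ state q :: (l.map tape ++ [right]))
  · convert pairStar_context (Rule.padRight (M := M))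
      (left :: tape default :: (r.reverse.map tape ++ state q :: l.map tape)) [] using 1 <;>
      simp [word]

theorem lagSolvable_of_halts_aux {M : TM0.Machine Γ Λ} {a b : Γ} {r l : List Γ} {q : Λ}
    {c c' : TM0.Cfg Γ Λ} (hc : cfg (a :: r) q (b :: l) = c)
    (hs : TM0.step M c = some c')
    (ih : ∀ r' q' l', cfg r' q' l' = c' → LagSolvable (rules M) halted (word r' q' l')) :
    LagSolvable (rules M) halted (word (a :: r) q (b :: l)) := by
  subst hc
  rw [step_cfg] at hs
  rcases hM : M q a with _ | ⟨q', d | a'⟩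
  · simp [hM] at hs
  · simp only [hM, Option.map_some, Option.some.injEq] at hs
    cases d with
    | left =>
      refine lagSolvable_of_pairStar ?_ (ih (b :: a :: r) q' l ?_)
      · simpa [word] using pairStar_context (Rule.moveLeft (M := M) b hM)
          (left :: r.reverse.map tape) (l.map tape ++ [right])
      · rw [← hs]
        simp [cfg, Tape.move_left_mk']
    | right =>
      refine lagSolvable_of_pairStar ?_ (ih r q' (a :: b :: l) ?_)
      · simpa [word] using pairStar_context (Rule.moveRight (M := M) hM)
          (left :: r.reverse.map tape) (tape b :: (l.map tape ++ [right]))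
      · rw [← hs]
        simp [cfg, Tape.move_right_mk']
  · simp only [hM, Option.map_some, Option.some.injEq] at hs
    refine lagSolvable_of_pairStar ?_ (ih (a' :: r) q' (b :: l) ?_)
    · simpa [word] using pairStar_context (Rule.write (M := M) hM)
        (left :: r.reverse.map tape) (tape b :: (l.map tape ++ [right]))
    · rw [← hs]
      simp [cfg, Tape.write_mk']

/-- Induction from the end of the computation: a solution for the next configuration word extends to
one for the current word. -/
theorem lagSolvable_of_halts {M : TM0.Machine Γ Λ} {c d : TM0.Cfg Γ Λ}
    (h : TM0.Reaches M c d) (hd : TM0.step M d = none) : ∀ r q l, cfg r q l = c →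
      LagSolvable (rules M) halted (word r q l) := by
  have key : ∀ r : List Γ, ∃ a r', r ++ [default] = a :: r' := by
    rintro (_ | ⟨a, r⟩)
    exacts [⟨_, _, rfl⟩, ⟨_, _, rfl⟩]
  induction h using Relation.ReflTransGen.head_induction_on with
  | refl =>
    intro r q l hc
    refine lagSolvable_word_pad ?_
    rw [← cfg_pad] at hc
    obtain ⟨a, r', hr⟩ := key r
    obtain ⟨b, l', hl⟩ := key l
    rw [hr, hl] at hc ⊢
    have hM : M q a = none := by
      rw [← hc, step_cfg] at hd
      simpa using hd
    let X : List (TMSymbol Γ Λ) := left :: r'.reverse.map tape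
    let Y : List (TMSymbol Γ Λ) := (b :: l').map tape ++ [right]
    -- Once `halted` is present, copying the part `X` before it is a solution.
    refine lagSolvable_of_pairStar (D := X ++ ([halted] ++ Y)) ?_
      ⟨X, X, Y ++ X, pairStar_refl M X, by simp⟩
    simpa [word, X, Y] using pairStar_context (Rule.halt (M := M) hM) X Y
  | head hs _ ih =>
    intro r q l hc
    refine lagSolvable_word_pad ?_
    rw [← cfg_pad] at hc
    obtain ⟨a, r', hr⟩ := key r
    obtain ⟨b, l', hl⟩ := key l
    rw [hr, hl] at hc ⊢
    exact lagSolvable_of_halts_aux hc hs ih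

theorem lagSolvable_init_iff (M : TM0.Machine Γ Λ) (w : List Γ) :
    LagSolvable (rules M) halted (word w default []) ↔ (TM0.eval M w).Dom := by
  have hi : cfg w (default : Λ) [] = TM0.init w := rfl
  have he : (TM0.eval M w).Dom ↔ ∃ c, TM0.Reaches M (TM0.init w) c ∧ TM0.step M c = none := by
    rw [TM0.eval, Part.map_Dom, Part.dom_iff_mem]
    simp only [StateTransition.mem_eval]
    rfl
  rw [he]
  exact ⟨fun h => hi ▸ halts_of_lagSolvable h,
    fun ⟨c, h1, h2⟩ => lagSolvable_of_halts h1 h2 _ _ _ hi⟩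

end TMSymbol

/-! ### Renaming of letters and the undecidable family over `Fin (k + 1)`. -/

section Transport

variable {σ τ : Type}

theorem PairStar.map (f : σ → τ) {E : Set (List σ × List σ)} {u v : List σ}
    (h : PairStar E u v) :
    PairStar (Prod.map (List.map f) (List.map f) '' E) (u.map f) (v.map f) := by
  induction h with
  | nil => exact .nil
  | cons hp _ ih => simpa using PairStar.cons (Set.mem_image_of_mem (Prod.map (List.map f) (List.map f)) hp) ih

theorem LagSolvable.map (f : σ → τ) {E : Set (List σ × List σ)} {h : σ} {C : List σ}
    (hs : LagSolvable E h C) :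
    LagSolvable (Prod.map (List.map f) (List.map f) '' E) (f h) (C.map f) := by
  obtain ⟨u, v, rest, hs, he⟩ := hs
  exact ⟨_, _, rest.map f, hs.map f, by simpa using congrArg (List.map f) he⟩

theorem lagSolvable_map_equiv (e : σ ≃ τ) {E : Set (List σ × List σ)} {h : σ} {C : List σ} :
    LagSolvable (Prod.map (List.map e) (List.map e) '' E) (e h) (C.map e) ↔
      LagSolvable E h C := by
  refine ⟨fun hs => ?_, LagSolvable.map e⟩
  have := hs.map e.symm
  have hid : (List.map e.symm ∘ List.map e) = id := by
    funext l
    simp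
  rw [← Set.image_comp, Prod.map_comp_map, hid, Prod.map_id, Set.image_id] at this
  simpa using this

end Transport

/-- An undecidable family of instances of `LagSolvable`, over a fixed alphabet and with fixed
pairs. -/
theorem exists_undecidable_lagSolvable :
    ∃ (k : ℕ) (E : Set (List (Fin (k + 1)) × List (Fin (k + 1)))) (h b s : Fin (k + 1))
      (w : List (Fin (k + 1))), E.Finite ∧ (∀ x, ([x], [x]) ∈ E) ∧ (∀ q, ([], q) ∉ E) ∧ w ≠ [] ∧
      h ≠ b ∧
      ¬ ComputablePred fun m : ℕ => LagSolvable E h (b :: (List.replicate (m + 1) s ++ w)) := by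
  obtain ⟨Γ, Λ, _, _, _, _, M, a, b, c, hu⟩ := exists_undecidable_TM0
  have hne : Nonempty (TMSymbol Γ Λ) := ⟨.left⟩
  obtain ⟨k, hk⟩ : ∃ k, Nat.card (TMSymbol Γ Λ) = k + 1 :=
    Nat.exists_eq_succ_of_ne_zero Nat.card_pos.ne'
  let e : TMSymbol Γ Λ ≃ Fin (k + 1) := Finite.equivFinOfCardEq hk
  -- As the tape is written from right to left, the unary block comes directly after the left border
  -- and the remaining word is independent of `m`. The border letter will also serve as the second
  -- counting letter.
  refine ⟨k, Prod.map (List.map e) (List.map e) '' TMSymbol.rules M, e .halted, e .left,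
    e (.tape a), [e (.tape b), e (.tape c), e (.state default), e .right],
    (TMSymbol.finite_rules M).image _, ?_, ?_, by simp, by simp, fun h => hu (h.of_eq fun m => ?_)⟩
  · intro x
    exact ⟨([e.symm x], [e.symm x]), .copy _, by simp⟩
  · rintro q ⟨⟨p, p'⟩, hp, he⟩
    have hp : TMSymbol.Rule M p p' := hp
    cases hp <;> simp at he
  · rw [← TMSymbol.lagSolvable_init_iff, ← lagSolvable_map_equiv e]
    simp [TMSymbol.word]

/-! ### Accepting runs, and automata given by words of reading operations. -/

namespace MultiTapeAutomaton

section Acceptance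

variable {n : ℕ} {σ Q : Type}

/-- `A` can reach an accepting state from state `q` with the tapes `c` still to be read. -/
def AcceptsFrom (A : MultiTapeAutomaton n σ Q) (q : Q) (c : Fin n → List (Option σ)) : Prop :=
  ∃ d : Config n σ Q, Relation.ReflTransGen A.Move (q, c) d ∧ d.1 ∈ A.accept

variable {A : MultiTapeAutomaton n σ Q}

theorem mem_language_iff {x : Fin n → List σ} :
    x ∈ A.language ↔ ∃ q ∈ A.start, A.AcceptsFrom q (input x) := Iff.rfl

theorem AcceptsFrom.of_mem {q : Q} (h : q ∈ A.accept) (c : Fin n → List (Option σ)) :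
    A.AcceptsFrom q c :=
  ⟨(q, c), .refl, h⟩

theorem AcceptsFrom.of_step {q q' : Q} {c : Fin n → List (Option σ)} {s : Option σ}
    {rest : List (Option σ)} (hc : c (A.tape q) = s :: rest) (hq : q' ∈ A.step q s)
    (h : A.AcceptsFrom q' (Function.update c (A.tape q) rest)) : A.AcceptsFrom q c := by
  obtain ⟨d, hd, ha⟩ := h
  exact ⟨d, .head ⟨s, rest, hc, hq, rfl⟩ hd, ha⟩

/-- Induction along accepting runs. -/
theorem AcceptsFrom.rec_on {P : Q → (Fin n → List (Option σ)) → Prop}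
    (accept : ∀ q c, q ∈ A.accept → P q c)
    (step : ∀ q q' c s rest, c (A.tape q) = s :: rest → q' ∈ A.step q s →
      P q' (Function.update c (A.tape q) rest) → P q c)
    {q : Q} {c : Fin n → List (Option σ)} (h : A.AcceptsFrom q c) : P q c := by
  obtain ⟨d, hd, ha⟩ := h
  suffices ∀ x : Config n σ Q, Relation.ReflTransGen A.Move x d → P x.1 x.2 from this _ hd
  intro x hx
  induction hx using Relation.ReflTransGen.head_induction_on with
  | refl => exact accept _ _ ha
  | @head x y hm _ ih =>
    obtain ⟨s, rest, h1, h2, h3⟩ := hm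
    exact step _ _ _ _ _ h1 h2 (h3 ▸ ih)

end Acceptance

section Reads

variable {n : ℕ} {σ : Type}

/-- The tapes `c` allow the reading operations of `w` (pairs of a tape and a symbol) in order. -/
def Reads : List (Fin n × Option σ) → (Fin n → List (Option σ)) → Prop
  | [], _ => True
  | (t, s) :: w, c => ∃ rest, c t = s :: rest ∧ Reads w (Function.update c t rest)

/-- What the reading operations of `w` read on tape `t`. -/
def onTape (t : Fin n) (w : List (Fin n × Option σ)) : List (Option σ) :=
  w.filterMap fun x => if x.1 = t then some x.2 else none

theorem onTape_append (t : Fin n) (w w' : List (Fin n × Option σ)) :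
    onTape t (w ++ w') = onTape t w ++ onTape t w' :=
  List.filterMap_append

theorem onTape_cons (t : Fin n) (x : Fin n × Option σ) (w : List (Fin n × Option σ)) :
    onTape t (x :: w) = if x.1 = t then x.2 :: onTape t w else onTape t w := by
  by_cases h : x.1 = t <;> simp [onTape, h]

theorem onTape_nil (t : Fin n) : onTape t ([] : List (Fin n × Option σ)) = [] := rfl

theorem onTape_map {α : Type} (t t' : Fin n) (g : α → Option σ) (u : List α) :
    onTape t (u.map fun a => (t', g a)) = if t' = t then u.map g else [] := by
  induction u with
  | nil => simp [onTape_nil]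
  | cons a u ih => by_cases h : t' = t <;> simp_all [onTape_cons]

/-- Readings on different tapes do not interfere, so only the word read on each single tape matters.
-/
theorem reads_iff (w : List (Fin n × Option σ)) : ∀ c : Fin n → List (Option σ),
    Reads w c ↔ ∀ t, onTape t w <+: c t := by
  induction w with
  | nil => intro c; simp [Reads, onTape_nil]
  | cons x w ih =>
    obtain ⟨t, s⟩ := x
    intro c
    simp only [Reads, ih, onTape_cons]
    constructor
    · rintro ⟨rest, hc, h⟩ t'
      by_cases ht : t = t'
      · subst ht
        have := h t
        simp only [Function.update_self] at this
        simpa [hc] using this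
      · have := h t'
        rw [Function.update_of_ne (Ne.symm ht)] at this
        simpa [ht] using this
    · intro h
      have h0 := h t
      simp only [if_true] at h0
      obtain ⟨rest, hr⟩ := h0
      refine ⟨onTape t w ++ rest, by simpa using hr.symm, fun t' => ?_⟩
      by_cases ht : t = t'
      · subst ht
        simp
      · have := h t'
        rw [Function.update_of_ne (Ne.symm ht)]
        simpa [ht] using this

end Reads

section WordAutomaton

variable {n : ℕ} {σ : Type} {w f : List (Fin n × Option σ)} {E : Set (List (Fin n × Option σ))}

/-- The states that stand for having to perform the operations `p` (then, if the flag is set, to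
continue with words from `E` and finally with `f`). -/
def wordStates (E : Set (List (Fin n × Option σ))) (f : List (Fin n × Option σ)) :
    List (Fin n × Option σ) → Bool → Set (List (Fin n × Option σ) × Bool)
  | [], true => {x | (x.1 ∈ E ∧ x.2 = true) ∨ x = (f, false)}
  | [], false => {([], false)}
  | a :: p, b => {(a :: p, b)}

/-- The operations that an accepting run of `wordAutomaton` from a given state performs. -/
def WordReads (E : Set (List (Fin n × Option σ))) (f : List (Fin n × Option σ)) :
    List (Fin n × Option σ) × Bool → (Fin n → List (Option σ)) → Prop
  | (p, true), c => ∃ l : List (List (Fin n × Option σ)), (∀ e ∈ l, e ∈ E) ∧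
      Reads (p ++ (l.flatten ++ f)) c
  | (p, false), c => Reads p c

theorem wordReads_of_mem_wordStates {p : List (Fin n × Option σ)} {b : Bool}
    {x : List (Fin n × Option σ) × Bool} {c : Fin n → List (Option σ)}
    (hx : x ∈ wordStates E f p b) (h : WordReads E f x c) : WordReads E f (p, b) c := by
  rcases p with _ | ⟨a, p⟩
  · cases b with
    | false => trivial
    | true =>
      rcases hx with ⟨he, hb⟩ | rfl
      · obtain ⟨e, b⟩ := x
        obtain rfl : b = true := hb
        obtain ⟨l, hl, hr⟩ := h
        exact ⟨e :: l, by simpa using ⟨he, hl⟩, by simpa using hr⟩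
      · exact ⟨[], by simp, by simpa using! h⟩
  · obtain rfl : x = (a :: p, b) := hx
    exact h

variable [NeZero n]

/-- The automaton that performs the reading operations of some word from `w E* f`. -/
def wordAutomaton (w : List (Fin n × Option σ)) (E : Set (List (Fin n × Option σ)))
    (f : List (Fin n × Option σ)) :
    MultiTapeAutomaton n σ (List (Fin n × Option σ) × Bool) where
  tape x := match x.1 with
    | [] => 0
    | a :: _ => a.1
  step x s := match x.1 with
    | [] => ∅
    | a :: p => {y | a.2 = s ∧ y ∈ wordStates E f p x.2}
  start := wordStates E f w true
  accept := {([], false)}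

theorem exists_acceptsFrom_cons (t : Fin n) (s : Option σ) (p : List (Fin n × Option σ)) (b : Bool)
    (c : Fin n → List (Option σ)) (rest : List (Option σ)) (hc : c t = s :: rest)
    (h : ∃ x ∈ wordStates E f p b,
      (wordAutomaton w E f).AcceptsFrom x (Function.update c t rest)) :
    ∃ x ∈ wordStates E f ((t, s) :: p) b, (wordAutomaton w E f).AcceptsFrom x c := by
  obtain ⟨x, hx, ha⟩ := h
  exact ⟨((t, s) :: p, b), rfl, .of_step (s := s) (rest := rest) hc ⟨rfl, hx⟩ ha⟩

theorem exists_acceptsFrom_of_reads_false (p : List (Fin n × Option σ)) :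
    ∀ c, Reads p c → ∃ x ∈ wordStates E f p false, (wordAutomaton w E f).AcceptsFrom x c := by
  induction p with
  | nil => exact fun c _ => ⟨([], false), rfl, .of_mem rfl c⟩
  | cons a p ih =>
    rintro c ⟨rest, hc, h⟩
    exact exists_acceptsFrom_cons _ _ _ _ _ _ hc (ih _ h)

/-- Induction over the words of `E` still to come, and within it over the operations pending. An
empty word in `E` would lead to the state `([], true)`, which has no moves. -/
theorem exists_acceptsFrom_of_reads_true (hE : [] ∉ E) (hf : f ≠ [])
    (l : List (List (Fin n × Option σ))) (hl : ∀ e ∈ l, e ∈ E) :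
    ∀ (p : List (Fin n × Option σ)) (c), Reads (p ++ (l.flatten ++ f)) c →
      ∃ x ∈ wordStates E f p true, (wordAutomaton w E f).AcceptsFrom x c := by
  induction l with
  | nil =>
    intro p
    induction p with
    | nil =>
      intro c h
      obtain ⟨x, hx, ha⟩ := exists_acceptsFrom_of_reads_false (w := w) (E := E) (f := f) f c h
      refine ⟨x, Or.inr ?_, ha⟩
      rcases f with _ | ⟨a, f⟩
      · exact absurd rfl hf
      · exact hx
    | cons a p ih =>
      rintro c ⟨rest, hc, h⟩
      exact exists_acceptsFrom_cons _ _ _ _ _ _ hc (ih _ h)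
  | cons e l ihl =>
    intro p
    induction p with
    | nil =>
      intro c h
      obtain ⟨x, hx, ha⟩ := ihl (fun e he => hl e (List.mem_cons_of_mem _ he)) e c
        (by simpa using h)
      have he := hl e List.mem_cons_self
      refine ⟨x, Or.inl ?_, ha⟩
      rcases e with _ | ⟨a, e⟩
      · exact absurd he hE
      · have hx : x = (a :: e, true) := hx
        simpa [hx] using he
    | cons a p ih =>
      rintro c ⟨rest, hc, h⟩
      exact exists_acceptsFrom_cons _ _ _ _ _ _ hc (ih _ h)

theorem wordReads_of_acceptsFrom {x : List (Fin n × Option σ) × Bool}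
    {c : Fin n → List (Option σ)} (h : (wordAutomaton w E f).AcceptsFrom x c) :
    WordReads E f x c := by
  refine h.rec_on ?_ ?_
  · rintro q c rfl
    trivial
  · rintro ⟨p, b⟩ q' c s rest hc hq ih
    rcases p with _ | ⟨⟨t, s'⟩, p⟩
    · exact hq.elim
    · obtain ⟨rfl, hq⟩ : s' = s ∧ q' ∈ wordStates E f p b := hq
      have h := wordReads_of_mem_wordStates hq ih
      cases b with
      | true =>
        obtain ⟨l, hl, hr⟩ := h
        exact ⟨l, hl, rest, hc, hr⟩
      | false => exact ⟨rest, hc, h⟩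

theorem mem_language_wordAutomaton (hE : [] ∉ E) (hf : f ≠ []) {x : Fin n → List σ} :
    x ∈ (wordAutomaton w E f).language ↔
      ∃ l : List (List (Fin n × Option σ)), (∀ e ∈ l, e ∈ E) ∧
        ∀ t, onTape t w ++ (onTape t l.flatten ++ onTape t f) <+: input x t := by
  simp only [← onTape_append, ← reads_iff]
  constructor
  · rintro ⟨q, hq, h⟩
    exact wordReads_of_mem_wordStates hq (wordReads_of_acceptsFrom h)
  · rintro ⟨l, hl, h⟩
    exact exists_acceptsFrom_of_reads_true hE hf l hl w _ h

/-- Finitely many states of `wordAutomaton` that are closed under its moves. -/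
theorem exists_finite_closed (hEf : E.Finite) (w : List (Fin n × Option σ)) :
    ∃ K : Set (List (Fin n × Option σ) × Bool), K.Finite ∧ wordStates E f w true ⊆ K ∧
      ∀ q ∈ K, ∀ s, (wordAutomaton w E f).step q s ⊆ K := by
  -- Pending operations are always a suffix of one of these finitely many words.
  let F : Set (List (Fin n × Option σ)) := insert [] (insert w (insert f E))
  have hF : F.Finite := ((hEf.insert f).insert w).insert []
  let K : Set (List (Fin n × Option σ) × Bool) := {x | ∃ y ∈ F, x.1 <:+ y}
  have hK : K.Finite := by
    have h1 : (⋃ y ∈ F, {p | p <:+ y}).Finite := hF.biUnion fun y _ =>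
      (List.finite_toSet y.tails).subset fun p hp => by simpa using hp
    refine (h1.prod (Set.finite_univ (α := Bool))).subset ?_
    rintro ⟨p, b⟩ ⟨y, hy, hp⟩
    exact ⟨Set.mem_biUnion hy hp, trivial⟩
  have hK' : ∀ p b, (p, b) ∈ K → wordStates E f p b ⊆ K := by
    rintro (_ | ⟨a, p⟩) (_ | _) h x hx
    · obtain rfl := hx
      exact h
    · rcases hx with ⟨he, -⟩ | rfl
      · exact ⟨x.1, by simp [F, he], List.suffix_rfl⟩
      · exact ⟨f, by simp [F], List.suffix_rfl⟩
    · obtain rfl := hx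
      exact h
    · obtain rfl := hx
      exact h
  refine ⟨K, hK, hK' _ _ ⟨w, by simp [F], List.suffix_rfl⟩, ?_⟩
  rintro ⟨p, b⟩ ⟨y, hy, hp⟩ s
  rcases p with _ | ⟨a, p⟩
  · exact Set.empty_subset _
  · rintro x ⟨-, hx⟩
    exact hK' p b ⟨y, hy, (List.suffix_cons a p).trans hp⟩ hx

end WordAutomaton

end MultiTapeAutomaton

/-! ### Finite descriptions of automata, and a computable family of them. -/

namespace AutomatonCode

open MultiTapeAutomaton

variable {n : ℕ} [NeZero n] {k : ℕ} {Q : Type}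

/-- Up to its initial states, the code `c` describes a part of the automaton `A` that is closed under
moves, where the number `i` stands for the state `st i`. -/
structure Represents (c : AutomatonCode) (st : ℕ → Q) (A : MultiTapeAutomaton n (Fin k) Q) :
    Prop where
  tape : ∀ i (h : i < c.1.length), Fin.ofNat n c.1[i] = A.tape (st i)
  step : ∀ i < c.1.length, ∀ s q,
    q ∈ A.step (st i) s ↔ ∃ j, (i, s.map Fin.val, j) ∈ c.2.1 ∧ st j = q
  accept : ∀ i < c.1.length, i ∈ c.2.2.2 ↔ st i ∈ A.accept
  lt_of_mem : ∀ x ∈ c.2.1, x.1 < c.1.length ∧ x.2.2 < c.1.length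
  lt_of_mem_accept : ∀ i ∈ c.2.2.2, i < c.1.length

variable {c : AutomatonCode} {st : ℕ → Q} {A : MultiTapeAutomaton n (Fin k) Q}

/-- The map `st` is a bisimulation, so runs transfer in both directions even if several numbers
stand for one state. -/
theorem Represents.acceptsFrom_iff (h : c.Represents st A) (i : Fin c.1.length)
    (x : Fin n → List (Option (Fin k))) :
    (c.toAutomaton n k).AcceptsFrom i x ↔ A.AcceptsFrom (st i) x := by
  have htape : ∀ i : Fin c.1.length, (c.toAutomaton n k).tape i = A.tape (st i) :=
    fun i => h.tape i i.2
  constructor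
  · intro ha
    refine ha.rec_on (P := fun (i : Fin c.1.length) x => A.AcceptsFrom (st i) x) ?_ ?_
    · exact fun q x hq => .of_mem ((h.accept q q.2).1 hq) x
    · intro q q' x s rest hx hq ih
      rw [htape] at hx ih
      exact .of_step hx ((h.step q q.2 s _).2 ⟨q', hq, rfl⟩) ih
  · intro ha
    refine ha.rec_on (P := fun q x => ∀ i : Fin c.1.length, st i = q →
      (c.toAutomaton n k).AcceptsFrom i x) ?_ ?_ i rfl
    · rintro _ x hq i rfl
      exact .of_mem ((h.accept i i.2).2 hq) x
    · rintro _ q' x s rest hx hq ih i rfl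
      obtain ⟨j, hj, rfl⟩ := (h.step i i.2 s q').1 hq
      rw [← htape] at hx ih
      exact .of_step (q' := ⟨j, (h.lt_of_mem _ hj).2⟩) hx hj (ih _ rfl)

theorem Represents.language_eq (h : c.Represents st A)
    (hs : ∀ q, q ∈ A.start ↔ ∃ i ∈ c.2.2.1, i < c.1.length ∧ st i = q) :
    (c.toAutomaton n k).language = A.language := by
  ext x
  rw [mem_language_iff, mem_language_iff]
  constructor
  · rintro ⟨i, hi, ha⟩
    exact ⟨st i, (hs _).2 ⟨i, hi, i.2, rfl⟩, (h.acceptsFrom_iff i _).1 ha⟩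
  · rintro ⟨q, hq, ha⟩
    obtain ⟨i, hi, hlt, rfl⟩ := (hs _).1 hq
    exact ⟨⟨i, hlt⟩, hi, (h.acceptsFrom_iff ⟨i, hlt⟩ _).2 ha⟩

theorem exists_represents (A : MultiTapeAutomaton n (Fin k) Q) {K : Set Q} (hK : K.Finite)
    (hA : ∀ q ∈ K, ∀ s, A.step q s ⊆ K) (q₀ : Q) (hq₀ : q₀ ∈ K) :
    ∃ (c : AutomatonCode) (st : ℕ → Q), c.Represents st A ∧
      (∀ q ∈ K, ∃ i < c.1.length, st i = q) ∧
      ∃ M, c.1.length = M + 1 ∧ st M = q₀ := by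
  classical
  -- Appending `q₀`, even as a repetition, gives it the largest number; a chain of new states can
  -- then be attached to it.
  let L : List Q := hK.toFinset.toList ++ [q₀]
  let st : ℕ → Q := fun i => L.getD i q₀
  have hst : ∀ i (h : i < L.length), st i = L[i] := fun i h => by simp [st, h]
  have hLK : ∀ q, q ∈ L ↔ q ∈ K := fun q => by
    simp only [L, List.mem_append, Finset.mem_toList, Set.Finite.mem_toFinset, List.mem_singleton]
    exact ⟨fun h => h.elim id fun h => h ▸ hq₀, Or.inl⟩
  have hsurj : ∀ q ∈ K, ∃ i < L.length, st i = q := fun q hq => by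
    obtain ⟨i, hi, he⟩ := List.mem_iff_getElem.1 ((hLK q).2 hq)
    exact ⟨i, hi, by rw [hst i hi, he]⟩
  let T : Set (ℕ × Option ℕ × ℕ) :=
    (fun x : Fin L.length × Option (Fin k) × Fin L.length =>
      ((x.1 : ℕ), x.2.1.map Fin.val, (x.2.2 : ℕ))) '' {x | st x.2.2 ∈ A.step (st x.1) x.2.1}
  have hT : T.Finite := Set.toFinite _
  refine ⟨(L.map fun q => (A.tape q : ℕ), hT.toFinset.toList, [],
    (List.range L.length).filter fun i => st i ∈ A.accept), st, ⟨?_, ?_, ?_, ?_, ?_⟩, ?_, ?_⟩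
  · intro i h
    simp only [List.length_map] at h
    simp [hst i h]
  · intro i hi s q
    simp only [List.length_map] at hi
    simp only [Finset.mem_toList, Set.Finite.mem_toFinset]
    constructor
    · intro hq
      have hiK : st i ∈ K := (hLK _).1 (by rw [hst i hi]; exact List.getElem_mem _)
      obtain ⟨j, hj, rfl⟩ := hsurj q (hA _ hiK s hq)
      exact ⟨j, ⟨(⟨i, hi⟩, s, ⟨j, hj⟩), hq, rfl⟩, rfl⟩
    · rintro ⟨j, ⟨⟨i', s', j'⟩, hx, he⟩, rfl⟩
      simp only [Prod.mk.injEq] at he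
      obtain ⟨rfl, hs, rfl⟩ := he
      obtain rfl := Option.map_injective Fin.val_injective hs
      exact hx
  · intro i hi
    simp only [List.length_map] at hi
    simp [hi]
  · intro x hx
    simp only [Finset.mem_toList, Set.Finite.mem_toFinset] at hx
    obtain ⟨y, -, rfl⟩ := hx
    simp
  · intro i hi
    simp only [List.mem_filter, List.mem_range] at hi
    simpa using hi.1
  · simpa using hsurj
  · refine ⟨hK.toFinset.toList.length, by simp [L], ?_⟩
    simp [st, L]

theorem exists_code (A : MultiTapeAutomaton n (Fin k) Q) {K : Set Q} (hK : K.Finite)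
    (hA : ∀ q ∈ K, ∀ s, A.step q s ⊆ K) (hs : A.start ⊆ K) (hne : A.start.Nonempty) :
    ∃ c : AutomatonCode, (c.toAutomaton n k).language = A.language := by
  classical
  obtain ⟨q₀, hq₀⟩ := hne
  obtain ⟨c, st, hc, hsurj, -⟩ := exists_represents A hK hA q₀ (hs hq₀)
  refine ⟨(c.1, c.2.1, (List.range c.1.length).filter fun i => st i ∈ A.start, c.2.2.2),
    Represents.language_eq (st := st) ⟨hc.tape, hc.step, hc.accept, hc.lt_of_mem,
      hc.lt_of_mem_accept⟩ fun q => ?_⟩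
  simp only [List.mem_filter, List.mem_range, decide_eq_true_eq]
  constructor
  · intro hq
    obtain ⟨i, hi, rfl⟩ := hsurj q (hs hq)
    exact ⟨i, ⟨hi, hq⟩, hi, rfl⟩
  · rintro ⟨i, ⟨-, hq⟩, -, rfl⟩
    exact hq

/-- Before entering the last state of `c`, first read the symbol `b` and then `m + 1` times the
symbol `s` on tape `0`. -/
def chain (c : AutomatonCode) (b s m : ℕ) : AutomatonCode :=
  (c.1 ++ List.replicate (m + 2) 0,
    (c.1.length + m + 1, some b, c.1.length + m) ::
      (c.2.1 ++ (List.range (m + 1)).map fun i => (c.1.length + i, some s, c.1.length + i - 1)),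
    [c.1.length + m + 1], c.2.2.2)

/-- This is the only part of the reduction that varies with `m`. -/
theorem computable_chain (c : AutomatonCode) (b s : ℕ) : Computable fun m => chain c b s m := by
  refine Primrec.to_comp ?_
  have hr : Primrec fun m : ℕ => List.replicate (m + 2) 0 := by
    refine ((Primrec.list_map (Primrec.list_range.comp
      (Primrec.nat_add.comp Primrec.id (Primrec.const 2))) (Primrec.const 0).to₂).of_eq ?_)
    intro m
    simp
  have hadd : ∀ d : ℕ, Primrec fun m : ℕ => d + m := fun d =>
    Primrec.nat_add.comp (Primrec.const d) Primrec.id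
  have hmap : Primrec fun m : ℕ => (List.range (m + 1)).map fun i =>
      (c.1.length + i, some s, c.1.length + i - 1) := by
    refine Primrec.list_map (Primrec.list_range.comp Primrec.succ) ?_
    refine Primrec.to₂ (Primrec.comp (f := fun i : ℕ =>
      (c.1.length + i, some s, c.1.length + i - 1)) ?_ Primrec.snd)
    exact (hadd _).pair ((Primrec.const (some s)).pair
      (Primrec.nat_sub.comp (hadd _) (Primrec.const 1)))
  refine Primrec.pair (Primrec.list_append.comp (Primrec.const c.1) hr) (Primrec.pair
    (Primrec.list_cons.comp ?_ (Primrec.list_append.comp (Primrec.const c.2.1) hmap))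
    (Primrec.pair ?_ (Primrec.const c.2.2.2)))
  · exact (Primrec.succ.comp (hadd _)).pair ((Primrec.const (some b)).pair (hadd _))
  · exact Primrec.list_cons.comp (Primrec.succ.comp (hadd _)) (Primrec.const [])

/-- The reading operations that spell `u` on tape `0`. -/
abbrev spell (u : List (Fin k)) : List (Fin n × Option (Fin k)) := u.map fun a => (0, some a)

theorem chain_language {c : AutomatonCode} {E : Set (List (Fin n × Option (Fin k)))}
    {f w₀ : List (Fin n × Option (Fin k))} {st : ℕ → List (Fin n × Option (Fin k)) × Bool}
    {w : List (Fin k)} (hw : w ≠ []) (hc : c.Represents st (wordAutomaton w₀ E f))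
    {M : ℕ} (hM : c.1.length = M + 1) (hst : st M = (spell w, true)) (b s : Fin k) (m : ℕ) :
    ((chain c b s m).toAutomaton n k).language =
      (wordAutomaton (spell (b :: (List.replicate (m + 1) s ++ w))) E f).language := by
  -- The new state `M + i`, for `1 ≤ i ≤ m + 1`, still has `i` letters `s` to read before `w`; the
  -- state `M + m + 2` has to read `b` first.
  let st' : ℕ → List (Fin n × Option (Fin k)) × Bool := fun i =>
    if i ≤ M then st i else if i ≤ M + m + 1 then (spell (List.replicate (i - M) s ++ w), true)
    else (spell (b :: (List.replicate (m + 1) s ++ w)), true)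
  have st'_le : ∀ i ≤ M, st' i = st i := fun i hi => if_pos hi
  have st'_mid : ∀ i ≤ m + 1, st' (M + i) = (spell (List.replicate i s ++ w), true) := by
    intro i hi
    rcases i with _ | i
    · simp [st', hst]
    · simp only [st']
      rw [if_neg (by omega), if_pos (by omega), Nat.add_sub_cancel_left]
  have st'_top : st' (M + m + 2) = (spell (b :: (List.replicate (m + 1) s ++ w)), true) := by
    simp only [st']
    rw [if_neg (by omega), if_neg (by omega)]
  -- As long as `u` is nonempty, there is a single successor and no branching into `E` or `f`.
  have hspell : ∀ (a : Fin k) (u : List (Fin k)) (s' : Option (Fin k)), u ≠ [] →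
      ∀ q, q ∈ (wordAutomaton w₀ E f).step (spell (a :: u), true) s' ↔
        some a = s' ∧ (spell u, true) = q := by
    rintro a (_ | ⟨a', u⟩) s' hu q
    · exact absurd rfl hu
    · exact ⟨fun h => ⟨h.1, Eq.symm h.2⟩, fun h => ⟨h.1, Eq.symm h.2⟩⟩
  have hlen : (chain c b s m).1.length = M + m + 3 := by
    simp only [chain, List.length_append, List.length_replicate]
    omega
  have hrep : (chain c b s m).Represents st' (wordAutomaton w₀ E f) := by
    refine ⟨?_, ?_, ?_, ?_, ?_⟩
    · intro i hi
      rw [hlen] at hi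
      by_cases hiM : i ≤ M
      · rw [st'_le i hiM, ← hc.tape i (by omega)]
        simp only [chain]
        rw [List.getElem_append_left]
      · simp only [chain]
        rw [List.getElem_append_right (by omega), List.getElem_replicate]
        obtain ⟨j, rfl⟩ : ∃ j, i = M + (j + 1) := ⟨i - M - 1, by omega⟩
        by_cases hj : j ≤ m
        · rw [st'_mid (j + 1) (by omega)]
          rfl
        · obtain rfl : j = m + 1 := by omega
          rw [show M + (m + 1 + 1) = M + m + 2 by omega, st'_top]
          rfl
    · intro i hi s' q
      rw [hlen] at hi
      simp only [chain, List.mem_cons, List.mem_append, List.mem_map, List.mem_range,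
        Prod.mk.injEq, hM]
      by_cases hiM : i ≤ M
      · rw [st'_le i hiM, hc.step i (by omega)]
        constructor
        · rintro ⟨j, hj, rfl⟩
          have : j < c.1.length := (hc.lt_of_mem _ hj).2
          exact ⟨j, .inr (.inl hj), st'_le j (by omega)⟩
        · rintro ⟨j, ⟨h, -⟩ | h | ⟨a, -, h, -⟩, rfl⟩
          · omega
          · have : j < c.1.length := (hc.lt_of_mem _ h).2
            exact ⟨j, h, (st'_le j (by omega)).symm⟩
          · omega
      · obtain ⟨j, rfl⟩ : ∃ j, i = M + (j + 1) := ⟨i - M - 1, by omega⟩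
        have hno : ∀ x y, (M + (j + 1), x, y) ∉ c.2.1 := fun x y h => by
          have := (hc.lt_of_mem _ h).1
          simp only at this
          omega
        by_cases hj : j ≤ m
        · rw [st'_mid (j + 1) (by omega), List.replicate_succ, List.cons_append,
            hspell _ _ _ (by simp [hw])]
          constructor
          · rintro ⟨rfl, rfl⟩
            exact ⟨M + j, .inr (.inr ⟨j, by omega, by omega, rfl, by omega⟩), st'_mid j (by omega)⟩
          · rintro ⟨j', ⟨h, -⟩ | h | ⟨a, ha, h1, h2, h3⟩, rfl⟩
            · omega
            · exact absurd h (hno _ _)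
            · obtain rfl : a = j := by omega
              obtain rfl : j' = M + a := by omega
              rw [st'_mid a (by omega)]
              refine ⟨Option.map_injective Fin.val_injective (by simpa using h2), rfl⟩
        · obtain rfl : j = m + 1 := by omega
          rw [show st' (M + (m + 1 + 1)) = _ from st'_top, hspell _ _ _ (by simp [hw])]
          constructor
          · rintro ⟨rfl, rfl⟩
            exact ⟨M + (m + 1), .inl ⟨by omega, rfl, by omega⟩, st'_mid _ le_rfl⟩
          · rintro ⟨j', ⟨h1, h2, h3⟩ | h | ⟨a, ha, h1, h2, h3⟩, rfl⟩
            · obtain rfl : j' = M + (m + 1) := by omega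
              rw [st'_mid _ le_rfl]
              exact ⟨Option.map_injective Fin.val_injective (by simpa using h2.symm), rfl⟩
            · exact absurd h (hno _ _)
            · omega
    · intro i hi
      rw [hlen] at hi
      by_cases hiM : i ≤ M
      · rw [st'_le i hiM]
        exact hc.accept i (by omega)
      · have h1 : i ∉ (chain c b s m).2.2.2 := fun h => by
          have := hc.lt_of_mem_accept i h
          omega
        refine iff_of_false h1 ?_
        obtain ⟨j, rfl⟩ : ∃ j, i = M + (j + 1) := ⟨i - M - 1, by omega⟩
        change st' _ ≠ ([], false)
        by_cases hj : j ≤ m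
        · rw [st'_mid (j + 1) (by omega)]
          simp
        · obtain rfl : j = m + 1 := by omega
          rw [show st' (M + (m + 1 + 1)) = _ from st'_top]
          simp
    · intro x hx
      rw [hlen]
      simp only [chain, List.mem_cons, List.mem_append, List.mem_map, List.mem_range, hM] at hx
      rcases hx with rfl | hx | ⟨a, ha, rfl⟩
      · constructor <;> simp only <;> omega
      · have := hc.lt_of_mem x hx
        constructor <;> omega
      · constructor <;> simp only <;> omega
    · intro i hi
      have := hc.lt_of_mem_accept i hi
      omega
  refine Represents.language_eq (st := st') ⟨hrep.tape, hrep.step, hrep.accept, hrep.lt_of_mem,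
    hrep.lt_of_mem_accept⟩ fun q => ?_
  rw [hlen]
  simp only [chain, List.mem_singleton, exists_eq_left, hM]
  rw [show M + 1 + m + 1 = M + m + 2 by omega, st'_top]
  constructor
  · exact fun h => ⟨by omega, Eq.symm h⟩
  · exact fun h => h.2.symm

end AutomatonCode

/-! ### A cut-and-paste criterion for non-rationality. -/

namespace MultiTapeAutomaton

variable {n : ℕ} {σ Q : Type} {A : MultiTapeAutomaton n σ Q}

/-- Tapewise concatenation. -/
def tapeAppend (u r : Fin n → List (Option σ)) : Fin n → List (Option σ) := fun t => u t ++ r t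

/-- An accepting run either passes through the point where exactly `s` is left on tape `t`, or it
ends earlier. -/
theorem AcceptsFrom.split {q : Q} {c : Fin n → List (Option σ)} (h : A.AcceptsFrom q c)
    (t : Fin n) (s : List (Option σ)) : ∀ p, c t = p ++ s →
      ∃ u r : Fin n → List (Option σ), c = tapeAppend u r ∧
        ((∃ q', r t = s ∧ A.AcceptsFrom q' r ∧
            ∀ r', A.AcceptsFrom q' r' → A.AcceptsFrom q (tapeAppend u r')) ∨
          ((∃ p', r t = p' ++ s) ∧ ∀ r', A.AcceptsFrom q (tapeAppend u r'))) := by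
  refine (h.rec_on (P := fun q c => A.AcceptsFrom q c ∧ ∀ p, c t = p ++ s →
      ∃ u r : Fin n → List (Option σ), c = tapeAppend u r ∧
        ((∃ q', r t = s ∧ A.AcceptsFrom q' r ∧
            ∀ r', A.AcceptsFrom q' r' → A.AcceptsFrom q (tapeAppend u r')) ∨
          ((∃ p', r t = p' ++ s) ∧ ∀ r', A.AcceptsFrom q (tapeAppend u r')))) ?_ ?_).2
  · exact fun q c hq => ⟨.of_mem hq c, fun p hp =>
      ⟨fun _ => [], c, rfl, .inr ⟨⟨p, hp⟩, fun r' => .of_mem hq _⟩⟩⟩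
  · rintro q q₁ c s₀ rest hc hq ⟨ha, ih⟩
    have hacc := AcceptsFrom.of_step hc hq ha
    refine ⟨hacc, fun p hp => ?_⟩
    rcases p with _ | ⟨a, p⟩
    -- Exactly `s` is left on tape `t`, so the run is cut here, with nothing read yet.
    · exact ⟨fun _ => [], c, rfl, .inl ⟨q, hp, hacc, fun r' h => h⟩⟩
    · obtain ⟨p', hp'⟩ : ∃ p', Function.update c (A.tape q) rest t = p' ++ s := by
        by_cases ht : t = A.tape q
        · subst ht
          rw [hp] at hc
          simp only [List.cons_append, List.cons.injEq] at hc
          exact ⟨p, by simp [hc.2]⟩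
        · exact ⟨a :: p, by rw [Function.update_of_ne ht, hp]⟩
      obtain ⟨u, r, hur, hcases⟩ := ih p' hp'
      have hstep : ∀ r', A.AcceptsFrom q₁ (tapeAppend u r') →
          A.AcceptsFrom q (tapeAppend (Function.update u (A.tape q) (s₀ :: u (A.tape q))) r') := by
        intro r' h
        refine .of_step (s := s₀) (rest := u (A.tape q) ++ r' (A.tape q)) (by simp [tapeAppend]) hq ?_
        convert h using 1
        funext t'
        by_cases ht : t' = A.tape q
        · subst ht
          simp [tapeAppend]
        · simp [tapeAppend, ht]
      refine ⟨Function.update u (A.tape q) (s₀ :: u (A.tape q)), r, ?_, ?_⟩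
      · funext t'
        have := congrFun hur t'
        by_cases ht : t' = A.tape q
        · subst ht
          simp only [Function.update_self, tapeAppend] at this
          simp [tapeAppend, hc, this]
        · simpa [tapeAppend, ht] using this
      · rcases hcases with ⟨q', h1, h2, h3⟩ | ⟨h1, h2⟩
        · exact .inl ⟨q', h1, h2, fun r' h => hstep r' (h3 r' h)⟩
        · exact .inr ⟨h1, fun r' => hstep r' (h2 r')⟩

/-- The read part of one input and the unread part of another combine to an input if the end-marker
lies on the same side of both cuts; an empty rest means that it has been read. -/
theorem exists_input_append {u r u' r' : List (Option σ)} {x x' : List σ}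
    (h : u ++ r = x.map some ++ [none]) (h' : u' ++ r' = x'.map some ++ [none])
    (hr : r = [] ↔ r' = []) : ∃ z : List σ, u ++ r' = z.map some ++ [none] := by
  have key : ∀ {u r : List (Option σ)} {x : List σ}, r ≠ [] → u ++ r = x.map some ++ [none] →
      ∃ y z : List σ, u = y.map some ∧ r = z.map some ++ [none] := by
    intro u r x hr h
    obtain ⟨r, a, rfl⟩ := List.eq_nil_or_concat' r |>.resolve_left hr
    rw [← List.append_assoc] at h
    obtain ⟨h1, h2⟩ := List.append_inj' h rfl
    obtain ⟨y, z, -, rfl, rfl⟩ := List.map_eq_append_iff.1 h1.symm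
    exact ⟨y, z, rfl, by rw [h2]⟩
  by_cases h0 : r = []
  · subst h0
    obtain rfl := hr.1 rfl
    exact ⟨x, h⟩
  · obtain ⟨y, -, rfl, -⟩ := key h0 h
    obtain ⟨-, z, -, rfl⟩ := key (fun hr' => h0 (hr.2 hr')) h'
    exact ⟨y ++ z, by simp⟩

theorem input_injective {x y : List σ} (h : x.map some ++ [none] = y.map some ++ [none]) :
    x = y :=
  List.map_injective_iff.2 (Option.some_injective σ) (List.append_inj' h rfl).1

/-- A language is not rational if on some tape it contains words `a ^ i b ^ i` with arbitrarily large
`i`, but no words `a ^ i b ^ j` with `i ≠ j`. -/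
theorem not_isRationalLanguage {L : Set (Fin n → List σ)} {a b : σ} (t : Fin n)
    (h₁ : ∀ z ∈ L, ∀ i j, z t = List.replicate i a ++ List.replicate j b → i = j)
    (h₂ : ∀ N, ∃ i > N, ∃ x ∈ L, x t = List.replicate i a ++ List.replicate i b) :
    ¬ IsRationalLanguage L := by
  rintro ⟨Q, _, A, rfl⟩
  let I : Set ℕ := {i | ∃ x ∈ A.language, x t = List.replicate i a ++ List.replicate i b}
  have hI : I.Infinite := Set.infinite_of_forall_exists_gt fun N => by
    obtain ⟨i, hi, hx⟩ := h₂ N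
    exact ⟨i, hx, hi⟩
  have hsplit : ∀ i : I, ∃ (x : Fin n → List σ) (q₀ q : Q) (u r : Fin n → List (Option σ)),
      input x = tapeAppend u r ∧ u t = List.replicate i (some a) ∧
      r t = List.replicate i (some b) ++ [none] ∧ q₀ ∈ A.start ∧ A.AcceptsFrom q r ∧
      ∀ r', A.AcceptsFrom q r' → A.AcceptsFrom q₀ (tapeAppend u r') := by
    rintro ⟨i, x, hx, hxt⟩
    obtain ⟨q₀, hq₀, ha⟩ := mem_language_iff.1 hx
    have hin : input x t =
        List.replicate i (some a) ++ (List.replicate i (some b) ++ [none]) := by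
      simp [input, hxt]
    obtain ⟨u, r, hur, ⟨q, hr, hq, hacc⟩ | ⟨⟨p', hr⟩, hacc⟩⟩ := ha.split t _ _ hin
    · refine ⟨x, q₀, q, u, r, hur, ?_, hr, hq₀, hq, hacc⟩
      have := congrFun hur t
      rw [tapeAppend, hr, hin] at this
      exact (List.append_cancel_right this).symm
    -- Here the run accepts without having read past the block of letters `a`. One more `a` inserted
    -- into the unread part goes unnoticed, so `a ^ (i + 1) b ^ i` would occur as well.
    · exfalso
      have hu := congrFun hur t
      rw [tapeAppend, hr, hin, ← List.append_assoc (u t)] at hu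
      have hup := List.append_cancel_right hu
      have hlen := congrArg List.length hup
      simp only [List.length_replicate, List.length_append] at hlen
      have hrep : u t ++ some a :: p' = List.replicate (i + 1) (some a) := by
        refine List.eq_replicate_iff.2 ⟨by simp; omega, fun y hy => ?_⟩
        have hmem : ∀ y ∈ u t ++ p', y = some a := fun y hy =>
          List.eq_of_mem_replicate (hup ▸ hy)
        simp only [List.mem_append, List.mem_cons] at hy hmem
        rcases hy with hy | hy | hy
        exacts [hmem y (.inl hy), hy, hmem y (.inr hy)]
      let z := Function.update x t (List.replicate (i + 1) a ++ List.replicate i b)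
      have hz : input z = tapeAppend u (Function.update r t (some a :: r t)) := by
        funext t'
        by_cases ht : t' = t
        · subst ht
          rw [tapeAppend, Function.update_self, hr, ← List.cons_append, ← List.append_assoc, hrep]
          simp [input, z]
        · have := congrFun hur t'
          simpa [tapeAppend, input, z, ht] using this
      have hzL : z ∈ A.language := mem_language_iff.2 ⟨q₀, hq₀, hz ▸ hacc _⟩
      have := h₁ z hzL (i + 1) i (by simp [z])
      omega
  choose x q₀ q u r hur hu hr hq₀ hq hacc using hsplit
  have : Infinite I := hI.to_subtype
  -- Pigeonhole on the state at the cut and on the set of tapes whose end-marker has been read; the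
  -- latter makes every tape of the spliced input well formed.
  obtain ⟨i, j, hij, he⟩ := Finite.exists_ne_map_eq_of_infinite
    fun i : I => (q i, fun t' => r i t' = [])
  simp only [Prod.mk.injEq] at he
  have hex : ∀ t', ∃ z : List σ, u i t' ++ r j t' = z.map some ++ [none] := fun t' =>
    exists_input_append (congrFun (hur i) t').symm (congrFun (hur j) t').symm
      (iff_of_eq (congrFun he.2 t'))
  choose z hz using hex
  have hzL : z ∈ A.language := by
    refine mem_language_iff.2 ⟨q₀ i, hq₀ i, ?_⟩
    rw [show input z = tapeAppend (u i) (r j) from funext fun t' => (hz t').symm]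
    exact hacc i _ (he.1 ▸ hq j)
  have hzt : z t = List.replicate i a ++ List.replicate j b := by
    refine input_injective ?_
    rw [← hz t, hu, hr]
    simp
  exact hij (Subtype.ext (h₁ z hzL i j hzt))

theorem isRationalLanguage_empty [NeZero n] :
    IsRationalLanguage (∅ : Set (Fin n → List σ)) := by
  refine ⟨Unit, inferInstance, ⟨fun _ => 0, fun _ _ => ∅, ∅, ∅⟩, ?_⟩
  refine Set.eq_empty_of_forall_notMem fun x hx => ?_
  obtain ⟨q, hq, -⟩ := mem_language_iff.1 hx
  exact hq

end MultiTapeAutomaton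

/-! ### From the correspondence problem to rational intersection. -/

open MultiTapeAutomaton

/-- Because of the identity pairs, `(C ++ u, C ++ v)` is again a solution; iterating makes `v`
arbitrarily long. -/
theorem LagSolvable.exists_lt_length {σ : Type} {E : Set (List σ × List σ)} {h : σ} {C : List σ}
    (hE : ∀ x, ([x], [x]) ∈ E) (hC : C ≠ []) (hs : LagSolvable E h C) (N : ℕ) :
    ∃ u v rest, PairStar E u v ∧ u ++ h :: rest = C ++ v ∧ N < v.length := by
  have hpos := List.length_pos_iff.2 hC
  have step : ∀ u v rest, PairStar E u v → u ++ h :: rest = C ++ v →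
      PairStar E (C ++ u) (C ++ v) ∧ (C ++ u) ++ h :: rest = C ++ (C ++ v) := fun u v rest h1 h2 =>
    ⟨(PairStar.refl hE C).append h1, by rw [List.append_assoc, h2]⟩
  induction N with
  | zero =>
    obtain ⟨u, v, rest, h1, h2⟩ := hs
    obtain ⟨h3, h4⟩ := step u v rest h1 h2
    exact ⟨_, _, rest, h3, h4, by simp only [List.length_append]; omega⟩
  | succ N ih =>
    obtain ⟨u, v, rest, h1, h2, hN⟩ := ih
    obtain ⟨h3, h4⟩ := step u v rest h1 h2
    exact ⟨_, _, rest, h3, h4, by simp only [List.length_append]; omega⟩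

theorem map_some_append_none_prefix {σ : Type} {u x : List σ} :
    u.map some ++ [none] <+: x.map some ++ [none] ↔ u = x := by
  classical
  refine ⟨fun ⟨r, hr⟩ => ?_, fun h => h ▸ List.prefix_rfl⟩
  have h' : u.map some ++ none :: r = x.map some ++ none :: [] := by simpa using hr
  rw [List.append_cons_inj_of_notMem (by simp)] at h'
  · exact List.map_injective_iff.2 (Option.some_injective σ) h'.1
  · have := congrArg (List.count none) h'
    simp only [List.count_append, List.count_cons_self, List.count_nil] at this
    have h0 : ∀ y : List σ, (y.map some).count none = 0 := fun y =>
      List.count_eq_zero.2 (by simp)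
    rw [h0, h0] at this
    exact List.count_eq_zero.1 (by omega)

theorem map_some_prefix {σ : Type} {u x : List σ} :
    u.map some <+: x.map some ++ [none] ↔ u <+: x := by
  rw [List.prefix_concat_iff]
  constructor
  · rintro (h | h)
    · have := congrArg (none ∈ ·) h
      simp at this
    · obtain ⟨r, hr⟩ := h
      obtain ⟨y, z, rfl, h1, -⟩ := List.map_eq_append_iff.1 hr.symm
      rw [List.map_injective_iff.2 (Option.some_injective σ) h1]
      exact ⟨z, rfl⟩
  · rintro ⟨z, rfl⟩
    exact .inr ⟨z.map some, by simp⟩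

theorem replicate_append_singleton_prefix {σ : Type} {a b : σ} (hab : a ≠ b) {m i j : ℕ}
    (h : List.replicate m a ++ [b] <+: List.replicate i a ++ List.replicate j b) : m = i := by
  induction m generalizing i with
  | zero =>
    rcases i with _ | i
    · rfl
    · obtain ⟨r, hr⟩ := h
      simp [List.replicate_succ, hab.symm] at hr
  | succ m ih =>
    rcases i with _ | i
    · obtain ⟨r, hr⟩ := h
      rcases j with _ | j <;> simp [List.replicate_succ, hab] at hr
    · simp only [List.replicate_succ, List.cons_append, List.cons_prefix_cons, true_and] at h
      rw [ih h]

namespace LagReduction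

variable {N k : ℕ}

/-- The reading operations for a pair: the components on tapes `0` and `1`, and on tape `2` the
length of the second component in unary. -/
def pairWord (a : Fin (k + 1)) (p : List (Fin (k + 1)) × List (Fin (k + 1))) :
    List (Fin (N + 3) × Option (Fin (k + 1))) :=
  p.1.map (fun c => (0, some c)) ++ (p.2.map (fun c => (1, some c)) ++
    p.2.map (fun _ => (2, some a)))

/-- The automaton that checks that a pair generated by `E` lies on the first two tapes. -/
def pairAutomaton (N : ℕ) (E : Set (List (Fin (k + 1)) × List (Fin (k + 1))))
    (h b : Fin (k + 1)) :=
  wordAutomaton (n := N + 3) [] (pairWord h '' E) [(1, none), (0, some h), (2, some b)]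

/-- The reading operations that compare the first two tapes and count on the third tape. -/
def copyWords (N : ℕ) (h b : Fin (k + 1)) : Set (List (Fin (N + 3) × Option (Fin (k + 1)))) :=
  insert [(2, some h)] (Set.range fun c => [(0, some c), (1, some c), (2, some b)])

/-- The automaton that checks that the first tape contains `C` and then a copy of the second tape. -/
def copyAutomaton (N : ℕ) (C : List (Fin (k + 1))) (h b : Fin (k + 1)) :=
  wordAutomaton (n := N + 3) (AutomatonCode.spell C) (copyWords N h b)
    [(0, none), (1, none), (2, none)]

theorem zero_ne_one : (0 : Fin (N + 3)) ≠ 1 := by simp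

theorem mod_two : 2 % (N + 3) = 2 := Nat.mod_eq_of_lt (by omega)

theorem zero_ne_two : (0 : Fin (N + 3)) ≠ 2 := by simp [Fin.ext_iff, mod_two]

theorem one_ne_two : (1 : Fin (N + 3)) ≠ 2 := by simp [Fin.ext_iff, mod_two]

theorem onTape_pairWord (a : Fin (k + 1)) (p : List (Fin (k + 1)) × List (Fin (k + 1)))
    (t : Fin (N + 3)) : onTape t (pairWord a p) =
      if t = 0 then p.1.map some else if t = 1 then p.2.map some else
        if t = 2 then (List.replicate p.2.length a).map some else [] := by
  simp only [pairWord, onTape_append, onTape_map]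
  by_cases h0 : t = 0
  · subst h0
    simp [zero_ne_one.symm, zero_ne_two.symm]
  by_cases h1 : t = 1
  · subst h1
    simp [zero_ne_one.symm, one_ne_two.symm]
  by_cases h2 : t = 2
  · subst h2
    simp [zero_ne_two, one_ne_two, zero_ne_two.symm, one_ne_two.symm]
  simp [h0, h1, h2, Ne.symm h0, Ne.symm h1, Ne.symm h2]

/-- Translates iterated reading operations into generated pairs. The condition `P` depends only on
what is read on each tape, so it carries over unchanged. -/
theorem pairStar_iff (E : Set (List (Fin (k + 1)) × List (Fin (k + 1)))) (a : Fin (k + 1))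
    (P : (Fin (N + 3) → List (Option (Fin (k + 1)))) → Prop) :
    (∃ l : List (List (Fin (N + 3) × Option (Fin (k + 1)))), (∀ e ∈ l, e ∈ pairWord a '' E) ∧
      P fun t => onTape t l.flatten) ↔
    ∃ u v, PairStar E u v ∧ P fun t => if t = 0 then u.map some else if t = 1 then v.map some else
        if t = 2 then (List.replicate v.length a).map some else [] := by
  constructor
  · rintro ⟨l, hl, hP⟩
    suffices ∃ u v, PairStar E u v ∧ (fun t => onTape t l.flatten) =
        fun t : Fin (N + 3) => if t = 0 then u.map some else if t = 1 then v.map some else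
        if t = 2 then (List.replicate v.length a).map some else [] by
      obtain ⟨u, v, h, he⟩ := this
      exact ⟨u, v, h, he ▸ hP⟩
    clear hP
    induction l with
    | nil => exact ⟨[], [], .nil, funext fun t => by simp [onTape_nil]⟩
    | cons e l ih =>
      obtain ⟨u, v, h, he⟩ := ih fun e he => hl e (List.mem_cons_of_mem _ he)
      obtain ⟨⟨p, q⟩, hp, rfl⟩ := hl e List.mem_cons_self
      refine ⟨p ++ u, q ++ v, .cons hp h, funext fun t => ?_⟩
      rw [List.flatten_cons, onTape_append, congrFun he t, onTape_pairWord]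
      split_ifs <;> simp
  · rintro ⟨u, v, h, hP⟩
    suffices ∃ l : List (List (Fin (N + 3) × Option (Fin (k + 1)))),
        (∀ e ∈ l, e ∈ pairWord a '' E) ∧ (fun t => onTape t l.flatten) =
        fun t : Fin (N + 3) => if t = 0 then u.map some else if t = 1 then v.map some else
        if t = 2 then (List.replicate v.length a).map some else [] by
      obtain ⟨l, hl, he⟩ := this
      exact ⟨l, hl, he ▸ hP⟩
    clear hP
    induction h with
    | nil => exact ⟨[], by simp, funext fun t => by simp [onTape_nil]⟩
    | @cons p q u v hp _ ih =>
      obtain ⟨l, hl, he⟩ := ih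
      refine ⟨pairWord a (p, q) :: l, ?_, funext fun t => ?_⟩
      · simpa using ⟨⟨p, q, hp, rfl⟩, by simpa using hl⟩
      · rw [List.flatten_cons, onTape_append, congrFun he t, onTape_pairWord]
        split_ifs <;> simp

theorem nil_notMem_pairWord {E : Set (List (Fin (k + 1)) × List (Fin (k + 1)))}
    (hE : ∀ q, ([], q) ∉ E) (a : Fin (k + 1)) : [] ∉ pairWord (N := N) a '' E := by
  rintro ⟨⟨p, q⟩, hp, he⟩
  simp only [pairWord, List.append_eq_nil_iff, List.map_eq_nil_iff] at he
  exact hE q (he.1 ▸ hp)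

theorem mem_pairAutomaton_language {E : Set (List (Fin (k + 1)) × List (Fin (k + 1)))}
    (hE : ∀ q, ([], q) ∉ E) (h b : Fin (k + 1)) (x : Fin (N + 3) → List (Fin (k + 1))) :
    x ∈ (pairAutomaton N E h b).language ↔ ∃ u v, PairStar E u v ∧ u ++ [h] <+: x 0 ∧ v = x 1 ∧
      List.replicate v.length h ++ [b] <+: x 2 := by
  rw [pairAutomaton, mem_language_wordAutomaton (nil_notMem_pairWord hE h) (by simp)]
  rw [pairStar_iff E h fun g => ∀ t, onTape t [] ++ (g t ++
    onTape t [(1, none), (0, some h), (2, some b)]) <+: input x t]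
  refine exists_congr fun u => exists_congr fun v => and_congr_right fun _ => ?_
  rw [← map_some_prefix, ← map_some_append_none_prefix (x := x 1), ← map_some_prefix (x := x 2)]
  simp only [onTape_cons, onTape_nil, List.nil_append]
  constructor
  · intro H
    have H0 := H 0
    have H1 := H 1
    have H2 := H 2
    simp only [zero_ne_one.symm, zero_ne_two.symm, zero_ne_one, one_ne_two.symm, one_ne_two,
      zero_ne_two, if_true, if_false] at H0 H1 H2
    exact ⟨by simpa using! H0, H1, by simpa using! H2⟩
  · rintro ⟨H0, H1, H2⟩ t
    by_cases h0 : t = 0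
    · subst h0
      simpa [zero_ne_one.symm, zero_ne_two.symm] using! H0
    by_cases h1 : t = 1
    · subst h1
      simpa [zero_ne_one, zero_ne_one.symm, one_ne_two.symm] using! H1
    by_cases h2 : t = 2
    · subst h2
      simpa [zero_ne_two, one_ne_two, zero_ne_two.symm, one_ne_two.symm] using! H2
    simp [h0, h1, h2, Ne.symm h0, Ne.symm h1, Ne.symm h2]

theorem nil_notMem_copyWords (h b : Fin (k + 1)) : [] ∉ copyWords N h b := by
  simp [copyWords]

/-- Each copied letter goes with one `b` on the third tape, where letters `h` may be interspersed
freely; the final end-markers force all three tapes to be read completely. -/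
theorem of_mem_copyAutomaton_language {C : List (Fin (k + 1))} {h b : Fin (k + 1)} (hb : h ≠ b)
    {x : Fin (N + 3) → List (Fin (k + 1))} (hx : x ∈ (copyAutomaton N C h b).language) :
    x 0 = C ++ x 1 ∧ (x 2).count b = (x 1).length := by
  rw [copyAutomaton, mem_language_wordAutomaton (nil_notMem_copyWords h b) (by simp)] at hx
  obtain ⟨l, hl, hx⟩ := hx
  obtain ⟨y, w, h0, h1, h2, hw⟩ : ∃ y w : List (Fin (k + 1)),
      onTape 0 l.flatten = y.map some ∧ onTape 1 l.flatten = y.map some ∧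
      onTape 2 l.flatten = w.map some ∧ w.count b = y.length := by
    clear hx
    induction l with
    | nil => exact ⟨[], [], by simp [onTape_nil]⟩
    | cons e l ih =>
      obtain ⟨y, w, h0, h1, h2, hw⟩ := ih fun e he => hl e (List.mem_cons_of_mem _ he)
      rcases hl e List.mem_cons_self with rfl | ⟨c, rfl⟩
      · refine ⟨y, h :: w, ?_⟩
        simp [onTape_cons, h0, h1, h2, hw, zero_ne_two.symm, one_ne_two.symm, hb]
      · refine ⟨c :: y, b :: w, ?_⟩
        simp [onTape_cons, h0, h1, h2, hw, zero_ne_two.symm, one_ne_two.symm,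
          zero_ne_one.symm, one_ne_two, zero_ne_two]
  have H0 := hx 0
  have H1 := hx 1
  have H2 := hx 2
  rw [h0, onTape_map] at H0
  rw [h1, onTape_map] at H1
  rw [h2, onTape_map] at H2
  simp only [onTape_cons, onTape_nil, zero_ne_one.symm, zero_ne_two.symm, zero_ne_one,
    one_ne_two.symm, one_ne_two, zero_ne_two, if_true, if_false, List.nil_append,
    ← List.append_assoc, ← List.map_append, input, map_some_append_none_prefix] at H0 H1 H2
  subst H1 H2
  exact ⟨H0.symm, hw⟩

theorem mem_copyAutomaton_language (C y : List (Fin (k + 1))) (h b : Fin (k + 1)) (i : ℕ)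
    {x : Fin (N + 3) → List (Fin (k + 1))} (hx0 : x 0 = C ++ y) (hx1 : x 1 = y)
    (hx2 : x 2 = List.replicate i h ++ List.replicate y.length b) :
    x ∈ (copyAutomaton N C h b).language := by
  rw [copyAutomaton, mem_language_wordAutomaton (nil_notMem_copyWords h b) (by simp)]
  have hcopy : ∃ l : List (List (Fin (N + 3) × Option (Fin (k + 1)))),
      (∀ e ∈ l, e ∈ copyWords N h b) ∧ ∀ t, onTape t l.flatten =
        if t = 0 then y.map some else if t = 1 then y.map some else
        if t = 2 then (List.replicate i h ++ List.replicate y.length b).map some else [] := by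
    clear hx0 hx1 hx2
    induction i with
    | zero =>
      induction y with
      | nil => exact ⟨[], by simp [onTape_nil]⟩
      | cons c y ih =>
        obtain ⟨l, hl, ht⟩ := ih
        refine ⟨[(0, some c), (1, some c), (2, some b)] :: l, ?_, fun t => ?_⟩
        · simpa using ⟨by simp [copyWords], hl⟩
        · rw [List.flatten_cons, onTape_append, ht t]
          by_cases h0 : t = 0
          · subst h0
            simp [onTape_cons, onTape_nil, zero_ne_one.symm, zero_ne_two.symm]
          by_cases h1 : t = 1
          · subst h1
            simp [onTape_cons, onTape_nil, zero_ne_one.symm, one_ne_two.symm]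
          by_cases h2 : t = 2
          · subst h2
            simp [onTape_cons, onTape_nil, zero_ne_two, one_ne_two, zero_ne_two.symm,
              one_ne_two.symm, List.replicate_succ]
          simp [onTape_cons, onTape_nil, h0, h1, h2, Ne.symm h0, Ne.symm h1, Ne.symm h2]
    | succ i ih =>
      obtain ⟨l, hl, ht⟩ := ih
      refine ⟨[(2, some h)] :: l, ?_, fun t => ?_⟩
      · simpa using ⟨by simp [copyWords], hl⟩
      · rw [List.flatten_cons, onTape_append, ht t, onTape_cons, onTape_nil]
        by_cases h2 : t = 2
        · subst h2
          simp [zero_ne_two.symm, one_ne_two.symm, List.replicate_succ]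
        · simp [h2, Ne.symm h2]
  obtain ⟨l, hl, ht⟩ := hcopy
  refine ⟨l, hl, fun t => ?_⟩
  rw [ht t, onTape_map]
  by_cases h0 : t = 0
  · subst h0
    simp [onTape_cons, onTape_nil, zero_ne_one.symm, zero_ne_two.symm, input, hx0]
  by_cases h1 : t = 1
  · subst h1
    simp [onTape_cons, onTape_nil, zero_ne_one.symm, one_ne_two.symm, input, hx1]
  by_cases h2 : t = 2
  · subst h2
    simp [onTape_cons, onTape_nil, zero_ne_two, one_ne_two, zero_ne_two.symm,
      one_ne_two.symm, input, hx2]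
  simp [onTape_cons, onTape_nil, h0, h1, h2, Ne.symm h0, Ne.symm h1, Ne.symm h2]

/-- On tape 2, one automaton ties the leading `h`-block and the other the number of letters `b` to
the length of tape 1. Neither compares the two blocks by itself, but together they force `h ^ i b ^
i`. -/
theorem isRationalLanguage_inter_iff {E : Set (List (Fin (k + 1)) × List (Fin (k + 1)))}
    (hE : ∀ q, ([], q) ∉ E) (hid : ∀ x, ([x], [x]) ∈ E) {h b : Fin (k + 1)} (hb : h ≠ b)
    {C : List (Fin (k + 1))} (hC : C ≠ []) :
    IsRationalLanguage ((pairAutomaton N E h b).language ∩ (copyAutomaton N C h b).language) ↔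
      ¬ LagSolvable E h C := by
  constructor
  · intro hr hs
    refine not_isRationalLanguage (a := h) (b := b) 2 ?_ ?_ hr
    · rintro z ⟨hz1, hz2⟩ i j hij
      obtain ⟨u, v, -, -, hv, hp⟩ := (mem_pairAutomaton_language hE h b z).1 hz1
      obtain ⟨-, hcount⟩ := of_mem_copyAutomaton_language hb hz2
      rw [hij] at hp hcount
      have h1 := replicate_append_singleton_prefix hb hp
      rw [← hv] at hcount
      simp only [List.count_append, List.count_replicate, beq_self_eq_true, if_true,
        beq_eq_false_iff_ne.2 hb, Bool.false_eq_true, if_false] at hcount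
      omega
    · intro M
      obtain ⟨u, v, rest, hp, he, hM⟩ := hs.exists_lt_length hid hC M
      -- The value on tapes beyond the third is irrelevant.
      let z : Fin (N + 3) → List (Fin (k + 1)) := fun t => if t = 0 then C ++ v else
        if t = 1 then v else List.replicate v.length h ++ List.replicate v.length b
      have hz1 : z 1 = v := by simp [z, zero_ne_one.symm]
      have hz2 : z 2 = List.replicate v.length h ++ List.replicate v.length b := by
        simp [z, zero_ne_two.symm, one_ne_two.symm]
      refine ⟨v.length, hM, z, ⟨?_, ?_⟩, hz2⟩
      · refine (mem_pairAutomaton_language hE h b z).2 ⟨u, v, hp, ⟨rest, ?_⟩, hz1.symm, ?_⟩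
        · simp [z, ← he]
        · obtain ⟨m, hm⟩ : ∃ m, v.length = m + 1 := ⟨v.length - 1, by omega⟩
          rw [hz2, hm]
          exact ⟨List.replicate m b, by simp [List.replicate_succ]⟩
      · exact mem_copyAutomaton_language C v h b v.length (by simp [z]) hz1 hz2
  · intro hs
    convert isRationalLanguage_empty (n := N + 3) (σ := Fin (k + 1))
    refine Set.eq_empty_of_forall_notMem ?_
    rintro z ⟨hz1, hz2⟩
    obtain ⟨u, v, hp, ⟨rest, hrest⟩, hv, -⟩ := (mem_pairAutomaton_language hE h b z).1 hz1
    obtain ⟨hz, -⟩ := of_mem_copyAutomaton_language hb hz2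
    exact hs ⟨u, v, rest, hp, by rw [hv, ← hz, ← hrest]; simp⟩

end LagReduction

/-! ### Undecidability. -/

open LagReduction in
theorem not_computablePred_rationalIntersection (N : ℕ) :
    ¬ ComputablePred (RationalIntersection (N + 3)) := by
  obtain ⟨k, E, h, b, s, w, hfin, hid, hE, hw, hb, hu⟩ := exists_undecidable_lagSolvable
  obtain ⟨K, hK, hKs, hKc⟩ := exists_finite_closed (n := N + 3)
    (f := [(1, none), (0, some h), (2, some b)]) (hfin.image (pairWord h)) []
  obtain ⟨cA, hcA⟩ := AutomatonCode.exists_code (pairAutomaton N E h b) hK hKc hKs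
    ⟨_, Or.inr rfl⟩
  have hcopy : (copyWords N h b).Finite := (Set.finite_range _).insert _
  obtain ⟨K', hK', hKs', hKc'⟩ := exists_finite_closed (n := N + 3)
    (f := [(0, none), (1, none), (2, none)]) hcopy (AutomatonCode.spell w)
  have hstart : (AutomatonCode.spell w, true) ∈ K' := by
    refine hKs' ?_
    rcases w with _ | ⟨c, w⟩
    · exact absurd rfl hw
    · rfl
  obtain ⟨cB, st, hrep, -, M, hM, hst⟩ := AutomatonCode.exists_represents _ hK' hKc' _ hstart
  intro hdec
  have hred := ManyOneReducible.mk (RationalIntersection (N + 3))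
    (((Computable.const k).pair ((Computable.const cA).pair
      (AutomatonCode.computable_chain cB b s))) : Computable fun m : ℕ =>
        (k, cA, AutomatonCode.chain cB b s m))
  -- Rationality corresponds to unsolvability, so the decision procedure is negated.
  refine hu ((ComputablePred.computable_of_manyOneReducible hred hdec).not.of_eq fun m => ?_)
  rw [RationalIntersection]
  simp only
  rw [hcA, AutomatonCode.chain_language hw hrep hM hst b s m]
  exact (not_congr (isRationalLanguage_inter_iff hE hid hb (by simp))).trans not_not

theorem mainTheorem6 :
    (¬ ComputablePred (fun p : ℕ × (ℕ × AutomatonCode × AutomatonCode) =>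
        RationalIntersection (p.1 + 1) p.2)) ∧
    (∀ (n : ℕ) [NeZero n], 3 ≤ n → ¬ ComputablePred (RationalIntersection n)) := by
  refine ⟨fun h => not_computablePred_rationalIntersection 0 ?_, fun n _ hn h => ?_⟩
  -- In the general problem the number of tapes is the first component plus one, so `2` encodes
  -- three tapes.
  · have hc : Computable fun q : ℕ × AutomatonCode × AutomatonCode => ((2 : ℕ), q) :=
      (Computable.const 2).pair Computable.id
    exact ComputablePred.computable_of_manyOneReducible ⟨_, hc, fun _ => Iff.rfl⟩ h
  · obtain ⟨N, rfl⟩ := Nat.exists_eq_add_of_le' hn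
    exact not_computablePred_rationalIntersection N h
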